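/- Let $A,B$ be finite-dimensional systems with $\dim A=d_A$, $\dim B=d_B$, each with a fixed orthonormal basis. Let $\mathcal N$ be a quantum channel (completely positive, trace preserving) and $\mathcal M$ a completely positive map, both from operators on $A$ to operators on $B$. Let $H$ be a Hermitian operator on $A$ and $E\in\mathbb R$, and assume that if some density operator $\rho$ on $A$ satisfies $\operatorname{Tr}[H\rho]\le E$, then some positive definite one does (that is, $E\ne\lambda_{\min}(H)$ unless $H$ is a multiple of the identity). For a state $\rho$ and a positive semidefinite $\sigma$ let $$D^M(\rho\|\sigma)=\sup_{(\Lambda_x)_x}\sum_x \operatorname{Tr}[\Lambda_x\rho]\ln\frac{\operatorname{Tr}[\Lambda_x\rho]}{\operatorname{Tr}[\Lambda_x\sigma]}\in(-\infty,+\infty],$$ the supremum being over all POVMs with finitely many outcomes, where $0\ln(0/q)=0$ and the sum is $+\infty$ if $\operatorname{Tr}[\Lambda_x\sigma]=0<\operatorname{Tr}[\Lambda_x\rho]$ for some $x$. Let $$D^M_{H,E}(\mathcal N\|\mathcal M)=\sup\{D^M((\mathrm{id}_{R'}\otimes\mathcal N)(\rho_{R'A})\,\|\,(\mathrm{id}_{R'}\otimes\mathcal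 M)(\rho_{R'A})):\operatorname{Tr}[H\rho_A]\le E\},$$ the supremum being over all finite-dimensional $R'$ and all density operators $\rho_{R'A}$, with $\rho_A=\operatorname{Tr}_{R'}\rho_{R'A}$ and $\sup\emptyset=-\infty$. Let $\Gamma^{\mathcal N}=\sum_{i,j}|i\rangle\langle j|\otimes\mathcal N(|i\rangle\langle j|)$ and $\Gamma^{\mathcal M}=\sum_{i,j}|i\rangle\langle j|\otimes\mathcal M(|i\rangle\langle j|)$ be the Choi operators, and let $P_{\ln}(X,Y)=X^{1/2}\ln(X^{-1/2}YX^{-1/2})X^{1/2}$ for positive definite $X,Y$. Then $$D^M_{H,E}(\mathcal N\|\mathcal M)=\sup\{\operatorname{Tr}[\Theta\Gamma^{\mathcal N}]-\operatorname{Tr}[\Omega\Gamma^{\mathcal M}]+1\},$$ where the supremum is over positive definite $\Omega$ and $\rho$ and Hermitian $\Theta$ with $\operatorname{Tr}\rho=1$, $\operatorname{Tr}[H\rho^{T}]\le E$ and $\Theta\le P_{\ln}(\rho\otimes I,\Omega)$; here $T$ is the transpose in the fixed basis of $A$, so that the constraint reads $\operatorname{Tr}[H\rho]\le E$ if $H$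 is real in this basis. For $m,k\in\mathbb N$ let $D^M_{H,E,m,k}(\mathcal N\|\mathcal M)$ be the supremum of $\operatorname{Tr}[\Theta\Gamma^{\mathcal N}]-\operatorname{Tr}[\Omega\Gamma^{\mathcal M}]+1$ over positive definite $\Omega$, $\rho$ and Hermitian $\Theta,T_1,\dots,T_m,Z_0,\dots,Z_k$ such that $\operatorname{Tr}\rho=1$, $\operatorname{Tr}[H\rho^T]\le E$, $Z_0=\Omega$, $\sum_{j=1}^m w_jT_j=2^{-k}\Theta$, and the following $k+m$ linear matrix inequalities of size $2d_Ad_B\times 2d_Ad_B$ hold: $$\begin{bmatrix}Z_i&Z_{i+1}\\Z_{i+1}&\rho\otimes I\end{bmatrix}\ge0\quad(0\le i<k),\qquad \begin{bmatrix}Z_k-\rho\otimes I-T_j&-\sqrt{t_j}\,T_j\\-\sqrt{t_j}\,T_j&\rho\otimes I-t_jT_j\end{bmatrix}\ge0\quad(1\le j\le m),$$ where $w_j$ and $t_j$ are the weights and nodes of the $m$-point Gauss--Legendre quadrature on $[0,1]$. If $D^M_{H,E}(\mathcal N\|\mathcal M)<+\infty$, then for every $\varepsilon>0$ there are $m=m(\varepsilon)\ge1$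 and $k=k(\varepsilon)$ such that $D^M_{H,E}(\mathcal N\|\mathcal M)\le D^M_{H,E,m,k}(\mathcal N\|\mathcal M)+\varepsilon$ and $D^M_{H,E,m,k}(\mathcal N\|\mathcal M)\le D^M_{H,E}(\mathcal N\|\mathcal M)+\varepsilon$ (that is, $|D^M_{H,E}(\mathcal N\|\mathcal M)-D^M_{H,E,m,k}(\mathcal N\|\mathcal M)|\le\varepsilon$ when the energy constraint is feasible), and $m(\varepsilon)+k(\varepsilon)=O(\sqrt{\ln(1/\varepsilon)})$ as $\varepsilon\to0^+$, with a constant that may depend on $\mathcal N,\mathcal M,H,E$. -/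

import Mathlib

open Matrix Asymptotics
open scoped Kronecker Topology ComplexOrder

namespace MeasuredChannel

section Maps

variable {A B R : Type*}

/-- The map `id_R ⊗ Φ` applied to an operator on the composite system `RA`; the result is an
operator on `RB`. Composite systems are indexed by product types. -/
def idTensor (Φ : Matrix A A ℂ →ₗ[ℂ] Matrix B B ℂ) (X : Matrix (R × A) (R × A) ℂ) :
    Matrix (R × B) (R × B) ℂ :=
  fun p q => Φ (fun a a' => X (p.1, a) (q.1, a')) p.2 q.2

/-- Complete positivity: `id_R ⊗ Φ` preserves positive semidefiniteness for every
finite-dimensional reference system `R`. -/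
def IsCompletelyPositive (Φ : Matrix A A ℂ →ₗ[ℂ] Matrix B B ℂ) : Prop :=
  ∀ (r : ℕ) (X : Matrix (Fin r × A) (Fin r × A) ℂ), X.PosSemidef → (idTensor Φ X).PosSemidef

/-- A quantum channel: a completely positive and trace-preserving linear map. -/
def IsChannel [Fintype A] [Fintype B] (Φ : Matrix A A ℂ →ₗ[ℂ] Matrix B B ℂ) : Prop :=
  IsCompletelyPositive Φ ∧ ∀ X : Matrix A A ℂ, (Φ X).trace = X.trace

/-- The maximally entangled operator `Γ_{RA} = ∑ i j, |i⟩⟨j| ⊗ |i⟩⟨j|`, with `R` a copy of `A`. -/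
def maxEntangled (A : Type*) [Fintype A] [DecidableEq A] : Matrix (A × A) (A × A) ℂ :=
  ∑ i : A, ∑ j : A, single i j (1 : ℂ) ⊗ₖ single i j (1 : ℂ)

/-- The Choi operator `Γ^Φ = (id_R ⊗ Φ)(Γ_{RA})`, an operator on `RB`. -/
def choi [Fintype A] [DecidableEq A] (Φ : Matrix A A ℂ →ₗ[ℂ] Matrix B B ℂ) :
    Matrix (A × B) (A × B) ℂ :=
  idTensor Φ (maxEntangled A)

/-- The partial trace over the first system, `ρ_A = Tr_R[ρ_{RA}]`. -/
def partialTraceLeft [Fintype R] (X : Matrix (R × A) (R × A) ℂ) : Matrix A A ℂ :=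
  fun a a' => ∑ r : R, X (r, a) (r, a')

end Maps

section Entropies

variable {n : Type*} [Fintype n]

/-- A density operator: positive semidefinite with unit trace. -/
def IsDensity (ρ : Matrix n n ℂ) : Prop :=
  ρ.PosSemidef ∧ ρ.trace = 1

/-- A positive operator-valued measure with outcomes in `X`. -/
def IsPOVM [DecidableEq n] {X : Type*} [Fintype X] (L : X → Matrix n n ℂ) : Prop :=
  (∀ x, (L x).PosSemidef) ∧ ∑ x, L x = 1

open Classical in
/-- The classical relative entropy `D(p‖q) = ∑ x, p x * ln (p x / q x)`, equal to `+∞` unless the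
support of `p` is contained in that of `q`. -/
noncomputable def relEntropy {X : Type*} [Fintype X] (p q : X → ℝ) : EReal :=
  if ∀ x, q x = 0 → p x = 0 then ((∑ x, p x * Real.log (p x / q x) : ℝ) : EReal) else ⊤

/-- The measured relative entropy `D^M(ρ‖σ)`: the supremum, over all finite alphabets and all
POVMs, of the relative entropy of the measurement outcomes. -/
noncomputable def measuredRelEntropy [DecidableEq n] (ρ σ : Matrix n n ℂ) : EReal :=
  sSup {v : EReal | ∃ (N : ℕ) (L : Fin N → Matrix n n ℂ), IsPOVM L ∧
    v = relEntropy (fun x => (L x * ρ).trace.re) (fun x => (L x * σ).trace.re)}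

/-- The energy-constrained measured relative entropy of maps, `D^M_{H,E}(N‖M)`: the supremum of
`D^M(N(ρ_{RA})‖M(ρ_{RA}))` over all finite-dimensional reference systems `R` and all states
`ρ_{RA}` with `Tr[H ρ_A] ≤ E`. -/
noncomputable def channelMeasuredRelEntropy {A B : Type*} [Fintype A]
    [Fintype B] [DecidableEq B] (N M : Matrix A A ℂ →ₗ[ℂ] Matrix B B ℂ)
    (H : Matrix A A ℂ) (E : ℝ) : EReal :=
  sSup {v : EReal | ∃ (r : ℕ) (ρ : Matrix (Fin r × A) (Fin r × A) ℂ), IsDensity ρ ∧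
    (H * partialTraceLeft ρ).trace.re ≤ E ∧
    v = measuredRelEntropy (idTensor N ρ) (idTensor M ρ)}

/-- The operator connection of the logarithm,
`P_ln(X, Y) = X^{1/2} ln(X^{-1/2} Y X^{-1/2}) X^{1/2}`, used for positive definite `X` and `Y`;
functions of Hermitian matrices are taken through the continuous functional calculus. -/
noncomputable def logPerspective [DecidableEq n] (X Y : Matrix n n ℂ) : Matrix n n ℂ :=
  cfc Real.sqrt X * cfc Real.log ((cfc Real.sqrt X)⁻¹ * Y * (cfc Real.sqrt X)⁻¹) * cfc Real.sqrt X

end Entropies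

section Quadrature

/-- The nodes of the `m`-point Gauss–Legendre quadrature on `[0, 1]`: the `m` roots, in increasing
order, of the Legendre polynomial of degree `m` shifted to `[0, 1]`. (There are exactly `m` real
roots, so the default value `0` is never used.) -/
noncomputable def glNode (m : ℕ) (j : Fin m) : ℝ :=
  ((((Polynomial.shiftedLegendre m).map (Int.castRingHom ℝ)).roots.sort (· ≤ ·)).getD j 0)

/-- The weights of the `m`-point Gauss–Legendre quadrature on `[0, 1]`: the integrals over `[0, 1]`
of the Lagrange basis polynomials of the nodes. -/
noncomputable def glWeight (m : ℕ) (j : Fin m) : ℝ :=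
  ∫ x in (0 : ℝ)..1, ∏ i ∈ Finset.univ.erase j, (x - glNode m i) / (glNode m j - glNode m i)

end Quadrature

/-- The optimal value `D^M_{H,E,m,k}(N‖M)` of the semidefinite program with `k + m` linear matrix
inequalities, each on a `2 d_A d_B`-dimensional space. The variable `ρ` lives on the reference
copy of `A`; the corresponding state of the input system is `ρᵀ`, because the reduced state on `A`
of `(√ρ ⊗ 1) Γ_{RA} (√ρ ⊗ 1)` is `ρᵀ`. -/
noncomputable def sdpValue {A B : Type*} [Fintype A] [DecidableEq A] [Fintype B] [DecidableEq B]
    (N M : Matrix A A ℂ →ₗ[ℂ] Matrix B B ℂ) (H : Matrix A A ℂ) (E : ℝ) (m k : ℕ) : EReal :=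
  sSup {v : EReal |
    ∃ (Ω : Matrix (A × B) (A × B) ℂ) (ρ : Matrix A A ℂ) (Θ : Matrix (A × B) (A × B) ℂ)
      (T : Fin m → Matrix (A × B) (A × B) ℂ) (Z : Fin (k + 1) → Matrix (A × B) (A × B) ℂ),
      Ω.PosDef ∧ ρ.PosDef ∧ Θ.IsHermitian ∧ (∀ j, (T j).IsHermitian) ∧
      (∀ i, (Z i).IsHermitian) ∧
      ρ.trace = 1 ∧ (H * ρᵀ).trace.re ≤ E ∧
      Z 0 = Ω ∧ ∑ j, (glWeight m j : ℂ) • T j = ((2 : ℂ) ^ k)⁻¹ • Θ ∧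
      (∀ i : Fin k, (fromBlocks (Z i.castSucc) (Z i.succ) (Z i.succ) (ρ ⊗ₖ 1)).PosSemidef) ∧
      (∀ j : Fin m, (fromBlocks
        (Z (Fin.last k) - ρ ⊗ₖ 1 - T j) (-((Real.sqrt (glNode m j) : ℂ) • T j))
        (-((Real.sqrt (glNode m j) : ℂ) • T j)) (ρ ⊗ₖ 1 - (glNode m j : ℂ) • T j)).PosSemidef) ∧
      v = (((Θ * choi N).trace.re - (Ω * choi M).trace.re + 1 : ℝ) : EReal)}

end MeasuredChannel

/-! A reference state together with a measurement of the channel output amounts to a tester: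
positive semidefinite operators `G x` with sum `ρ ⊗ 1`, whose statistics on a map `Φ` are `Tr[G x
Γ^Φ]`. Every input and POVM yield a tester (`exists_isTester`), and every tester with invertible `ρ`
arises in this way (`relEntropy_outcome_le`). The channel quantity thus becomes a supremum of
classical relative entropies `D(p‖q)` over testers.

Gibbs' principle writes `D(p‖q)` as the supremum over weights `w > 0` of `∑ (p ln w - q w) + 1`. A
tester with weights gives `Ω = ∑ w G` and `Θ = ∑ ln w • G`, and the operator Jensen inequality
(`posSemidef_logPerspective_sub_sum`) gives `Θ ≤ P_ln(ρ ⊗ 1, Ω)`. Conversely, a congruence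
diagonalizing both `ρ ⊗ 1` and `Ω` produces a tester with `Ω = ∑ y G` and `P_ln = ∑ ln y • G`
(`exists_spectral_tester`). This proves the variational formula.

For the semidefinite programs, `ln` is replaced by `approxLog`: `k` square roots followed by
`m`-point quadrature of `ln x = ∫₀¹ (x-1)/(1+t(x-1)) dt`. The matrix inequalities fit the same
dictionary: `∑ approxLog w • G` is certified (`isCertified_sum`), and every certified `Θ` lies below
`∑ approxLog y • G` for the spectral tester (`IsCertified.posSemidef_sub`). Only a scalar comparison
of `approxLog` with `ln` remains.

Raising weights to at least `δ ~ ε` costs at most `δ Tr Γ^M`. Above `1` the approximation never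
exceeds `ln`. If the value is finite and the constraint is feasible, then `Γ^N ≤ C Γ^M`, so the
optimal weights `p / q` are at most `C`. Hence accuracy is needed only where `|ln x| ≤ ln(1/ε) +
const`. There the error bound `2^k (4|ln x|/2^k)^(2m+1)` drops below order `ε` for `m` and `k` of
order `√(ln(1/ε))`. -/

namespace MeasuredChannel

/-! ### Gauss–Legendre quadrature: nodes, exactness, positive weights. -/

section GaussLegendre

open Polynomial

theorem intervalIntegrable_eval (p : ℝ[X]) (a b : ℝ) :
    IntervalIntegrable (fun x => p.eval x) MeasureTheory.volume a b :=
  p.continuous.intervalIntegrable a b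

theorem integral_eval_add (p q : ℝ[X]) :
    ∫ x in (0 : ℝ)..1, (p + q).eval x
      = (∫ x in (0 : ℝ)..1, p.eval x) + ∫ x in (0 : ℝ)..1, q.eval x := by
  simp only [eval_add]
  exact intervalIntegral.integral_add (intervalIntegrable_eval p 0 1) (intervalIntegrable_eval q 0 1)

/-- A nonzero polynomial which is nonnegative on `(0, 1]` has positive integral. -/
theorem integral_eval_pos {p : ℝ[X]} (hp : p ≠ 0) (h : ∀ x ∈ Set.Ioc (0 : ℝ) 1, 0 ≤ p.eval x) :
    0 < ∫ x in (0 : ℝ)..1, p.eval x := by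
  refine intervalIntegral.integral_pos zero_lt_one p.continuous.continuousOn h ?_
  by_contra! hc
  refine hp (eq_zero_of_infinite_isRoot p ((Set.Ioc_infinite (zero_lt_one' ℝ)).mono ?_))
  exact fun x hx => le_antisymm (hc x ⟨hx.1.le, hx.2⟩) (h x hx)

/-- Repeated integration by parts. -/
theorem integral_iterate_derivative_mul_eq_zero (n : ℕ) (f : ℝ[X])
    (hf : ∀ i < n, (derivative^[i] f).eval 0 = 0 ∧ (derivative^[i] f).eval 1 = 0) :
    ∀ q : ℝ[X], q.degree < n → ∫ x in (0 : ℝ)..1, (derivative^[n] f * q).eval x = 0 := by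
  induction n with
  | zero =>
    intro q hq
    have : q = 0 := by simpa using hq
    simp [this]
  | succ n ih =>
    intro q hq
    have hq' : (derivative q).degree < n := by
      by_cases h0 : q = 0
      · simp [h0]
      · have h1 := degree_derivative_lt h0
        rw [degree_eq_natDegree h0] at h1 hq
        refine h1.trans_le ?_
        norm_cast at hq ⊢
        omega
    have h2 := ih (fun i hi => hf i (by omega)) _ hq'
    have h3 := intervalIntegral.integral_deriv_mul_eq_sub (a := 0) (b := 1)
      (u := fun x => (derivative^[n] f).eval x) (v := fun x => q.eval x)
      (u' := fun x => (derivative^[n + 1] f).eval x) (v' := fun x => (derivative q).eval x)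
      (fun x _ => by rw [Function.iterate_succ_apply']; exact Polynomial.hasDerivAt _ x)
      (fun x _ => Polynomial.hasDerivAt _ x)
      (intervalIntegrable_eval _ 0 1) (intervalIntegrable_eval _ 0 1)
    simp only [(hf n (by omega)).1, (hf n (by omega)).2, zero_mul, sub_zero, ← eval_mul,
      ← eval_add] at h3
    rw [integral_eval_add, h2, add_zero] at h3
    exact h3

/-- The shifted Legendre polynomial with real coefficients. -/
noncomputable def realLegendre (m : ℕ) : ℝ[X] :=
  (shiftedLegendre m).map (Int.castRingHom ℝ)

theorem degree_realLegendre (m : ℕ) : (realLegendre m).degree = m := by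
  rw [realLegendre, degree_map_eq_of_injective (RingHom.injective_int _), degree_shiftedLegendre]

theorem natDegree_realLegendre (m : ℕ) : (realLegendre m).natDegree = m :=
  natDegree_eq_of_degree_eq_some (degree_realLegendre m)

theorem realLegendre_ne_zero (m : ℕ) : realLegendre m ≠ 0 := by
  intro h
  simpa [h] using degree_realLegendre m

/-- Rodrigues' formula makes the polynomial an `m`-th derivative, up to `m!`, of `X^m (1 - X)^m`.
Derivatives of order `i < m` keep the factors `X^(m-i)` and `(1-X)^(m-i)`, so all boundary terms
vanish. -/
theorem integral_realLegendre_mul_eq_zero {m : ℕ} {q : ℝ[X]} (hq : q.degree < m) :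
    ∫ x in (0 : ℝ)..1, (realLegendre m * q).eval x = 0 := by
  have h1 : ((m.factorial : ℕ) : ℝ[X]) * realLegendre m
      = derivative^[m] (X ^ m * (1 - X) ^ m) := by
    have := congrArg (Polynomial.map (Int.castRingHom ℝ)) (factorial_mul_shiftedLegendre_eq m)
    rw [← Polynomial.iterate_derivative_map] at this
    simpa [realLegendre] using this
  have h2 := integral_iterate_derivative_mul_eq_zero m (X ^ m * (1 - X) ^ m : ℝ[X]) (by
    intro i hi
    constructor
    · obtain ⟨c, hc⟩ := pow_sub_dvd_iterate_derivative_of_pow_dvd i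
        (dvd_mul_right (X ^ m) ((1 - X) ^ m : ℝ[X]))
      rw [hc]; simp [show m - i ≠ 0 by omega]
    · obtain ⟨c, hc⟩ := pow_sub_dvd_iterate_derivative_of_pow_dvd i
        (dvd_mul_left ((1 - X) ^ m) (X ^ m : ℝ[X]))
      rw [hc]; simp [show m - i ≠ 0 by omega]) q hq
  rw [← h1, mul_assoc] at h2
  simp only [eval_natCast_mul, intervalIntegral.integral_const_mul] at h2
  exact (mul_eq_zero.1 h2).resolve_left (by exact_mod_cast m.factorial_ne_zero)

/-- A nonconstant factor of the Legendre polynomial cannot be nonnegative on `(0, 1]`. -/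
theorem exists_eval_neg_of_dvd_realLegendre {m : ℕ} {g : ℝ[X]} (hg : g ∣ realLegendre m)
    (hd : 0 < g.degree) : ∃ x ∈ Set.Ioc (0 : ℝ) 1, g.eval x < 0 := by
  by_contra! hc
  obtain ⟨q, hq⟩ := hg
  have hne := realLegendre_ne_zero m
  rw [hq] at hne
  have hg0 : g ≠ 0 := left_ne_zero_of_mul hne
  have hq0 : q ≠ 0 := right_ne_zero_of_mul hne
  have hdeg : q.degree < m := by
    rw [← degree_realLegendre m, hq, degree_mul, degree_eq_natDegree hg0, degree_eq_natDegree hq0]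
    rw [degree_eq_natDegree hg0] at hd
    norm_cast at hd ⊢
    omega
  -- The cofactor `q` has degree below `m`, so it is orthogonal to `g * q`; but `g * q * q` is
  -- nonnegative if `g` is.
  have h1 := integral_realLegendre_mul_eq_zero hdeg
  have h2 : 0 < ∫ x in (0 : ℝ)..1, (realLegendre m * q).eval x := by
    refine integral_eval_pos (mul_ne_zero (hq ▸ hne) hq0) fun x hx => ?_
    rw [hq, eval_mul, eval_mul, mul_assoc]
    exact mul_nonneg (hc x hx) (mul_self_nonneg _)
  exact h2.ne' h1

/-- For `a ≤ 0` the factor `X - a`, and for `a ≥ 1` its negative, would be nonnegative on `(0, 1]`.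
-/
theorem mem_Ioo_of_isRoot_realLegendre {m : ℕ} {a : ℝ} (ha : (realLegendre m).IsRoot a) :
    a ∈ Set.Ioo (0 : ℝ) 1 := by
  have hd := dvd_iff_isRoot.2 ha
  constructor
  · obtain ⟨x, hx, h⟩ := exists_eval_neg_of_dvd_realLegendre hd (by simp)
    simp only [eval_sub, eval_X, eval_C] at h
    linarith [hx.1]
  · obtain ⟨x, hx, h⟩ := exists_eval_neg_of_dvd_realLegendre (neg_dvd.2 hd)
      (by rw [degree_neg]; simp)
    simp only [eval_neg, eval_sub, eval_X, eval_C] at h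
    linarith [hx.2]

theorem nodup_roots_realLegendre (m : ℕ) : (realLegendre m).roots.Nodup := by
  rw [Multiset.nodup_iff_count_le_one]
  intro a
  by_contra! hc
  rw [count_roots] at hc
  have hd := (le_rootMultiplicity_iff (realLegendre_ne_zero m)).1 hc
  obtain ⟨x, -, h⟩ := exists_eval_neg_of_dvd_realLegendre hd (by
    rw [degree_pow]; simp)
  simp only [eval_pow, eval_sub, eval_X, eval_C] at h
  exact absurd h (not_lt.2 (sq_nonneg _))

theorem eval_pos_or_neg_of_no_root {g : ℝ[X]} (h : ∀ x, g.eval x ≠ 0) :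
    (∀ x, 0 < g.eval x) ∨ (∀ x, g.eval x < 0) := by
  by_contra! hc
  obtain ⟨⟨a, ha⟩, ⟨b, hb⟩⟩ := hc
  obtain ⟨c, hc⟩ := mem_range_of_exists_le_of_exists_ge g.continuous ⟨a, ha⟩ ⟨b, hb⟩
  exact h c hc

/-- An irreducible factor without a real root has constant sign, so it or its negative would be a
nonnegative nonconstant factor. -/
theorem splits_realLegendre (m : ℕ) : (realLegendre m).Splits := by
  have key : ∀ g : ℝ[X], Irreducible g → g ∣ realLegendre m → g.degree = 1 := by
    intro g hg hd
    have hpos := degree_pos_of_irreducible hg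
    by_cases hr : ∃ x, g.eval x = 0
    · obtain ⟨x, hx⟩ := hr
      exact degree_eq_one_of_irreducible_of_root hg hx
    · push Not at hr
      exfalso
      rcases eval_pos_or_neg_of_no_root hr with h | h
      · obtain ⟨x, -, hx⟩ := exists_eval_neg_of_dvd_realLegendre hd hpos
        exact absurd hx (h x).le.not_gt
      · obtain ⟨x, -, hx⟩ := exists_eval_neg_of_dvd_realLegendre (neg_dvd.2 hd)
          (by rwa [degree_neg])
        rw [eval_neg] at hx
        linarith [h x]
  obtain ⟨u, hu⟩ := UniqueFactorizationMonoid.factors_prod (realLegendre_ne_zero m)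
  rw [← hu]
  refine (Splits.multisetProd fun g hg => ?_).mul u.isUnit.splits
  exact Splits.of_degree_eq_one (key g (UniqueFactorizationMonoid.irreducible_of_factor g hg)
    (UniqueFactorizationMonoid.dvd_of_mem_factors hg))

theorem length_sort_roots (m : ℕ) :
    ((realLegendre m).roots.sort (· ≤ ·)).length = m := by
  rw [Multiset.length_sort, splits_iff_card_roots.1 (splits_realLegendre m),
    natDegree_realLegendre]

theorem glNode_eq_getElem (m : ℕ) (j : Fin m) :
    glNode m j = ((realLegendre m).roots.sort (· ≤ ·))[(j : ℕ)]'(by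
      rw [length_sort_roots]; exact j.2) := by
  rw [glNode]
  exact List.getD_eq_getElem _ _ _

theorem glNode_isRoot (m : ℕ) (j : Fin m) : (realLegendre m).IsRoot (glNode m j) := by
  rw [glNode_eq_getElem]
  have := List.getElem_mem (l := (realLegendre m).roots.sort (· ≤ ·)) (n := j)
    (by rw [length_sort_roots]; exact j.2)
  rw [Multiset.mem_sort] at this
  exact (mem_roots'.1 this).2

theorem glNode_mem_Ioo (m : ℕ) (j : Fin m) : glNode m j ∈ Set.Ioo (0 : ℝ) 1 :=
  mem_Ioo_of_isRoot_realLegendre (glNode_isRoot m j)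

theorem glNode_injective (m : ℕ) : Function.Injective (glNode m) := by
  intro i j h
  rw [glNode_eq_getElem, glNode_eq_getElem] at h
  have hn : ((realLegendre m).roots.sort (· ≤ ·)).Nodup := by
    rw [← Multiset.coe_nodup, Multiset.sort_eq]
    exact nodup_roots_realLegendre m
  exact Fin.ext ((hn.getElem_inj_iff).1 h)

theorem glWeight_eq_integral_basis (m : ℕ) (j : Fin m) :
    glWeight m j = ∫ x in (0 : ℝ)..1, (Lagrange.basis Finset.univ (glNode m) j).eval x := by
  rw [glWeight]
  congr 1
  funext x
  rw [Lagrange.basis, eval_prod]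
  refine Finset.prod_congr rfl fun i _ => ?_
  simp [Lagrange.basisDivisor, div_eq_inv_mul]

theorem sum_glWeight_mul_eval_of_degree_lt {m : ℕ} {p : ℝ[X]} (hp : p.degree < m) :
    ∑ j, glWeight m j * p.eval (glNode m j) = ∫ x in (0 : ℝ)..1, p.eval x := by
  have h := Lagrange.eq_interpolate (s := Finset.univ) (v := glNode m) (f := p)
    (glNode_injective m).injOn (by simpa using hp)
  conv_rhs => rw [h]
  rw [Lagrange.interpolate_apply]
  simp only [eval_finsetSum, eval_mul, eval_C]
  rw [intervalIntegral.integral_finsetSum fun i _ =>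
    (intervalIntegrable_eval _ 0 1).const_mul _]
  refine Finset.sum_congr rfl fun j _ => ?_
  rw [intervalIntegral.integral_const_mul, ← glWeight_eq_integral_basis, mul_comm]

/-- Gauss–Legendre quadrature with `m` nodes is exact in degree less than `2 m`. -/
theorem sum_glWeight_mul_eval {m : ℕ} {p : ℝ[X]} (hp : p.degree < (m + m : ℕ)) :
    ∑ j, glWeight m j * p.eval (glNode m j) = ∫ x in (0 : ℝ)..1, p.eval x := by
  have hL := realLegendre_ne_zero m
  -- The multiple of the Legendre polynomial integrates to zero by orthogonality and vanishes at the
  -- nodes; interpolation handles the remainder.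
  have hdiv := EuclideanDomain.div_add_mod p (realLegendre m)
  have hmod : (p % realLegendre m).degree < m := by
    have := EuclideanDomain.mod_lt p hL
    rwa [← degree_realLegendre m]
  have hquot : (p / realLegendre m).degree < m := by
    rcases lt_or_ge p.degree (realLegendre m).degree with h | h
    · rw [(Polynomial.div_eq_zero_iff hL).2 h]; simp
    · have h2 := Polynomial.degree_add_div hL h
      by_cases h0 : p / realLegendre m = 0
      · rw [h0]; simp
      rw [← h2, degree_realLegendre, degree_eq_natDegree h0] at hp
      rw [degree_eq_natDegree h0]
      norm_cast at hp ⊢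
      omega
  rw [← hdiv, integral_eval_add, integral_realLegendre_mul_eq_zero hquot, zero_add,
    ← sum_glWeight_mul_eval_of_degree_lt hmod]
  refine Finset.sum_congr rfl fun j _ => ?_
  have := glNode_isRoot m j
  rw [IsRoot.def] at this
  rw [eval_add, eval_mul, this, zero_mul, zero_add]

/-- The squared Lagrange basis polynomial has degree `2m - 2`, so quadrature is exact on it and
returns the single weight `glWeight m j`. -/
theorem glWeight_pos (m : ℕ) (j : Fin m) : 0 < glWeight m j := by
  have hm : 0 < m := j.pos
  set b := Lagrange.basis Finset.univ (glNode m) j with hb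
  have hinj := (glNode_injective m).injOn (s := (Finset.univ : Finset (Fin m)))
  have hb0 : b ≠ 0 := Lagrange.basis_ne_zero hinj (Finset.mem_univ j)
  have hdeg : b.degree = ((m - 1 : ℕ) : WithBot ℕ) := by
    rw [hb, Lagrange.degree_basis hinj (Finset.mem_univ j)]; simp
  have h := sum_glWeight_mul_eval (m := m) (p := b * b) (by
    rw [degree_mul, hdeg]
    norm_cast
    omega)
  rw [Finset.sum_eq_single j] at h
  · rw [eval_mul, hb, Lagrange.eval_basis_self hinj (Finset.mem_univ j), mul_one, mul_one] at h
    rw [h]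
    refine integral_eval_pos (mul_ne_zero hb0 hb0) fun x _ => ?_
    rw [eval_mul]
    exact mul_self_nonneg _
  · intro i _ hij
    rw [eval_mul, hb, Lagrange.eval_basis_of_ne hij.symm (Finset.mem_univ i)]
    ring
  · simp

end GaussLegendre

/-! ### Rational approximation of the scalar logarithm. -/

section RationalLog

open Polynomial

/-- The integrand of `log x = ∫ t in 0..1, (x - 1) / (1 + t * (x - 1))`. -/
noncomputable def logKernel (t x : ℝ) : ℝ := (x - 1) / (1 + t * (x - 1))

/-- The Gauss–Legendre approximation of the logarithm. -/
noncomputable def quadLog (m : ℕ) (x : ℝ) : ℝ := ∑ j, glWeight m j * logKernel (glNode m j) x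

/-- The Gauss–Legendre approximation of the logarithm after `k` square roots. -/
noncomputable def approxLog (m k : ℕ) (x : ℝ) : ℝ := 2 ^ k * quadLog m (Real.sqrt^[k] x)

theorem one_add_mul_sub_one_pos {t x : ℝ} (ht : t ∈ Set.Icc (0 : ℝ) 1) (hx : 0 < x) :
    0 < 1 + t * (x - 1) := by
  rcases eq_or_lt_of_le ht.1 with h | h
  · simp [← h]
  · nlinarith [mul_pos h hx, ht.2]

theorem logKernel_mono {t x y : ℝ} (ht : t ∈ Set.Icc (0 : ℝ) 1) (hx : 0 < x) (hxy : x ≤ y) :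
    logKernel t x ≤ logKernel t y := by
  rw [logKernel, logKernel, div_le_div_iff₀ (one_add_mul_sub_one_pos ht hx)
    (one_add_mul_sub_one_pos ht (hx.trans_le hxy))]
  linarith

theorem quadLog_mono (m : ℕ) {x y : ℝ} (hx : 0 < x) (hxy : x ≤ y) :
    quadLog m x ≤ quadLog m y :=
  Finset.sum_le_sum fun j _ => mul_le_mul_of_nonneg_left
    (logKernel_mono (Set.Ioo_subset_Icc_self (glNode_mem_Ioo m j)) hx hxy) (glWeight_pos m j).le

theorem integral_logKernel {x : ℝ} (hx : 0 < x) :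
    ∫ t in (0 : ℝ)..1, (x - 1) / (1 + t * (x - 1)) = Real.log x := by
  have hpos : ∀ t ∈ Set.uIcc (0 : ℝ) 1, 0 < 1 + t * (x - 1) := fun t ht =>
    one_add_mul_sub_one_pos (by rwa [Set.uIcc_of_le zero_le_one] at ht) hx
  rw [intervalIntegral.integral_eq_sub_of_hasDerivAt
    (f := fun t : ℝ => Real.log (1 + t * (x - 1)))]
  · simp
  · intro t ht
    have h := (((hasDerivAt_id t).mul_const (x - 1)).const_add 1).log (hpos t ht).ne'
    simpa using h
  · refine ContinuousOn.intervalIntegrable (ContinuousOn.div (by fun_prop) (by fun_prop) ?_)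
    exact fun t ht => (hpos t ht).ne'

theorem eval_nodal_glNode_ne_zero (m : ℕ) {c : ℝ} (hc : c ∉ Set.Ioo (0 : ℝ) 1) :
    (Lagrange.nodal Finset.univ (glNode m)).eval c ≠ 0 := by
  rw [Lagrange.eval_nodal, Finset.prod_ne_zero_iff]
  intro j _ h
  exact hc (by rw [sub_eq_zero.1 h]; exact glNode_mem_Ioo m j)

theorem neg_inv_sub_one_notMem_Ioo {x : ℝ} (hx : 0 < x) (hx1 : x ≠ 1) :
    -(x - 1)⁻¹ ∉ Set.Ioo (0 : ℝ) 1 := by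
  rintro ⟨h0, h1⟩
  have hs : x - 1 ≠ 0 := sub_ne_zero.2 hx1
  have hneg : x - 1 < 0 := by
    by_contra! h
    exact absurd h0 (by simpa using inv_nonneg.2 h)
  have : -(x - 1)⁻¹ * (x - 1) = -1 := by field_simp
  nlinarith

/-- The error of the quadrature approximation of the logarithm. -/
theorem log_sub_quadLog (m : ℕ) {x : ℝ} (hx : 0 < x) (hx1 : x ≠ 1) :
    Real.log x - quadLog m x
      = (x - 1) / ((Lagrange.nodal Finset.univ (glNode m)).eval (-(x - 1)⁻¹)) ^ 2
        * ∫ t in (0 : ℝ)..1,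
          ((Lagrange.nodal Finset.univ (glNode m)).eval t) ^ 2 / (1 + t * (x - 1)) := by
  have hs : x - 1 ≠ 0 := sub_ne_zero.2 hx1
  have hc := eval_nodal_glNode_ne_zero m (neg_inv_sub_one_notMem_Ioo hx hx1)
  have hlog := integral_logKernel hx
  have hpos : ∀ t ∈ Set.uIcc (0 : ℝ) 1, 0 < 1 + t * (x - 1) := fun t ht =>
    one_add_mul_sub_one_pos (by rwa [Set.uIcc_of_le zero_le_one] at ht) hx
  set s := x - 1 with hsdef
  set P := Lagrange.nodal Finset.univ (glNode m) with hP
  set c := -s⁻¹ with hcdef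
  have hPdeg : P.degree = m := by rw [hP, Lagrange.degree_nodal]; simp
  -- `c` is the pole of the integrand `s / (1 + t s)`. Dividing `P(c)² - P²` by `X - c` removes it
  -- and leaves degree below `2m`, where quadrature is exact. Since `P` vanishes at the nodes,
  -- quadrature of `R` is `P(c)²` times `quadLog`; the `P²` term is the error.
  obtain ⟨R, hR⟩ := dvd_iff_isRoot.2
    (show (C (P.eval c ^ 2) - P ^ 2).IsRoot c by simp [IsRoot.def])
  have hRdeg : R.degree < (m + m : ℕ) := by
    by_cases h0 : R = 0
    · rw [h0, degree_zero]; exact WithBot.bot_lt_coe _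
    have h1 : (C (P.eval c ^ 2) - P ^ 2).degree ≤ (m + m : ℕ) := by
      refine (degree_sub_le _ _).trans (max_le (degree_C_le.trans ?_) ?_)
      · exact_mod_cast Nat.zero_le _
      · rw [sq, degree_mul, hPdeg]; norm_cast
    rw [hR, degree_mul, degree_X_sub_C, degree_eq_natDegree h0] at h1
    rw [degree_eq_natDegree h0]
    norm_cast at h1 ⊢
    omega
  have hReval : ∀ t, 1 + t * s ≠ 0 →
      R.eval t = s * (P.eval c ^ 2 - P.eval t ^ 2) / (1 + t * s) := by
    intro t ht
    have h1 := congrArg (Polynomial.eval t) hR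
    simp only [eval_sub, eval_C, eval_pow, eval_mul, eval_X] at h1
    rw [h1, eq_div_iff ht, hcdef]
    field_simp
    ring
  have hquad := sum_glWeight_mul_eval hRdeg
  have hL : ∑ j, glWeight m j * R.eval (glNode m j) = P.eval c ^ 2 * quadLog m x := by
    rw [quadLog, Finset.mul_sum]
    refine Finset.sum_congr rfl fun j _ => ?_
    have hz : P.eval (glNode m j) = 0 := Lagrange.eval_nodal_at_node (Finset.mem_univ j)
    rw [hReval _ (one_add_mul_sub_one_pos
      (Set.Ioo_subset_Icc_self (glNode_mem_Ioo m j)) hx).ne', hz, logKernel]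
    ring
  have hI : ∫ t in (0 : ℝ)..1, R.eval t
      = P.eval c ^ 2 * Real.log x - s * ∫ t in (0 : ℝ)..1, P.eval t ^ 2 / (1 + t * s) := by
    rw [← hlog, ← intervalIntegral.integral_const_mul, ← intervalIntegral.integral_const_mul,
      ← intervalIntegral.integral_sub]
    · refine intervalIntegral.integral_congr fun t ht => ?_
      rw [hReval t (hpos t ht).ne']
      ring
    · exact ContinuousOn.intervalIntegrable (continuousOn_const.mul
        (ContinuousOn.div (by fun_prop) (by fun_prop) fun t ht => (hpos t ht).ne'))
    · exact ContinuousOn.intervalIntegrable (continuousOn_const.mul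
        (ContinuousOn.div (P.continuous.pow 2).continuousOn (by fun_prop)
          fun t ht => (hpos t ht).ne'))
  rw [hL, hI] at hquad
  rw [div_mul_eq_mul_div, eq_div_iff (pow_ne_zero 2 hc)]
  linarith

theorem quadLog_one (m : ℕ) : quadLog m 1 = 0 := by
  simp [quadLog, logKernel]

theorem quadLog_le_log (m : ℕ) {x : ℝ} (hx : 1 ≤ x) : quadLog m x ≤ Real.log x := by
  rcases eq_or_lt_of_le hx with h | h
  · rw [← h, quadLog_one, Real.log_one]
  · have hx0 : 0 < x := by linarith
    have h1 := log_sub_quadLog m hx0 h.ne'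
    have h2 : 0 ≤ ∫ t in (0 : ℝ)..1,
        ((Lagrange.nodal Finset.univ (glNode m)).eval t) ^ 2 / (1 + t * (x - 1)) :=
      intervalIntegral.integral_nonneg zero_le_one fun t ht =>
        div_nonneg (sq_nonneg _) (one_add_mul_sub_one_pos ht hx0).le
    have h3 : 0 ≤ (x - 1) / ((Lagrange.nodal Finset.univ (glNode m)).eval (-(x - 1)⁻¹)) ^ 2 :=
      div_nonneg (by linarith) (sq_nonneg _)
    linarith [mul_nonneg h3 h2]

/-- The pole has modulus `|x-1|⁻¹ ≥ 2`, hence distance at least `(2|x-1|)⁻¹` from each node, while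
the remaining integral is at most `2`. -/
theorem abs_log_sub_quadLog_le (m : ℕ) {x : ℝ} (hx : |x - 1| ≤ 1 / 2) :
    |Real.log x - quadLog m x| ≤ (2 * |x - 1|) ^ (2 * m + 1) := by
  by_cases hx1 : x = 1
  · simp [hx1, quadLog_one]
  have hx0 : 0 < x := by linarith [(abs_le.1 hx).1]
  have hs : 0 < |x - 1| := abs_pos.2 (sub_ne_zero.2 hx1)
  rw [log_sub_quadLog m hx0 hx1, abs_mul, abs_div, abs_pow]
  set P := Lagrange.nodal Finset.univ (glNode m) with hP
  have hden : (2 * |x - 1|)⁻¹ ^ m ≤ |P.eval (-(x - 1)⁻¹)| := by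
    rw [hP, Lagrange.eval_nodal, Finset.abs_prod]
    have : (2 * |x - 1|)⁻¹ ^ m = ∏ _j : Fin m, (2 * |x - 1|)⁻¹ := by simp
    rw [this]
    refine Finset.prod_le_prod (fun j _ => by positivity) fun j _ => ?_
    have h1 := abs_sub_abs_le_abs_sub (-(x - 1)⁻¹) (glNode m j)
    have h2 := glNode_mem_Ioo m j
    rw [abs_neg, abs_inv, abs_of_pos h2.1] at h1
    have h3 : 2 ≤ |x - 1|⁻¹ := by
      rw [le_inv_comm₀ two_pos hs]; linarith
    rw [mul_inv]
    linarith [h2.2]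
  have hint : |∫ t in (0 : ℝ)..1, P.eval t ^ 2 / (1 + t * (x - 1))| ≤ 2 := by
    have := intervalIntegral.norm_integral_le_of_norm_le_const (a := 0) (b := 1) (C := 2)
      (f := fun t : ℝ => P.eval t ^ 2 / (1 + t * (x - 1))) (by
        intro t ht
        rw [Set.uIoc_of_le zero_le_one] at ht
        have h1 : |P.eval t| ≤ 1 := by
          rw [hP, Lagrange.eval_nodal, Finset.abs_prod]
          refine Finset.prod_le_one (fun _ _ => abs_nonneg _) fun j _ => ?_
          have := glNode_mem_Ioo m j
          rw [abs_le]
          constructor <;> linarith [this.1, this.2, ht.1, ht.2]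
        have h2 : 1 / 2 ≤ 1 + t * (x - 1) := by
          have := (abs_le.1 hx).1
          nlinarith [ht.1, ht.2]
        rw [Real.norm_eq_abs, abs_div, abs_pow, abs_of_pos (by linarith : 0 < 1 + t * (x - 1)),
          div_le_iff₀ (by linarith)]
        nlinarith [abs_nonneg (P.eval t)])
    simpa using this
  have hp : 0 < (2 * |x - 1|)⁻¹ ^ m := by positivity
  calc |x - 1| / |P.eval (-(x - 1)⁻¹)| ^ 2 * |∫ t in (0 : ℝ)..1, P.eval t ^ 2 / (1 + t * (x - 1))|
      ≤ |x - 1| / ((2 * |x - 1|)⁻¹ ^ m) ^ 2 * 2 := by gcongr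
    _ = (2 * |x - 1|) ^ (2 * m + 1) := by
        rw [← pow_mul, inv_pow, div_inv_eq_mul, pow_succ, mul_comm m 2]; ring

theorem iterate_sqrt_pos (k : ℕ) {x : ℝ} (hx : 0 < x) : 0 < Real.sqrt^[k] x := by
  induction k with
  | zero => simpa
  | succ k ih => rw [Function.iterate_succ_apply']; exact Real.sqrt_pos.2 ih

theorem log_iterate_sqrt (k : ℕ) {x : ℝ} (hx : 0 < x) :
    Real.log (Real.sqrt^[k] x) = Real.log x / 2 ^ k := by
  induction k with
  | zero => simp
  | succ k ih =>
    rw [Function.iterate_succ_apply', Real.log_sqrt (iterate_sqrt_pos k hx).le, ih, pow_succ]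
    field_simp

theorem iterate_sqrt_mono (k : ℕ) {x y : ℝ} (hxy : x ≤ y) : Real.sqrt^[k] x ≤ Real.sqrt^[k] y :=
  (Monotone.iterate (fun _ _ h => Real.sqrt_le_sqrt h) k) hxy

theorem approxLog_mono (m k : ℕ) {x y : ℝ} (hx : 0 < x) (hxy : x ≤ y) :
    approxLog m k x ≤ approxLog m k y :=
  mul_le_mul_of_nonneg_left (quadLog_mono m (iterate_sqrt_pos k hx) (iterate_sqrt_mono k hxy))
    (by positivity)

theorem approxLog_le_log (m k : ℕ) {x : ℝ} (hx : 1 ≤ x) : approxLog m k x ≤ Real.log x := by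
  have h1 : 1 ≤ Real.sqrt^[k] x := by
    have h := iterate_sqrt_mono k hx
    rwa [Function.iterate_fixed Real.sqrt_one] at h
  have h2 := quadLog_le_log m h1
  rw [log_iterate_sqrt k (by linarith), le_div_iff₀ (by positivity)] at h2
  rw [approxLog]
  linarith

/-- After `k` roots the logarithm is `ln x / 2^k`, of modulus at most `1/4`. The `4` combines `|z -
1| ≤ 2 |ln z|` with the factor `2` in the quadrature bound; undoing the roots multiplies the error
by `2^k`. -/
theorem abs_approxLog_sub_log_le (m k : ℕ) {x : ℝ} (hx : 0 < x)
    (h : 4 * |Real.log x| ≤ 2 ^ k) :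
    |approxLog m k x - Real.log x| ≤ 2 ^ k * (4 * |Real.log x| / 2 ^ k) ^ (2 * m + 1) := by
  have h2k : (0 : ℝ) < 2 ^ k := by positivity
  set z := Real.sqrt^[k] x with hz
  have hz0 : 0 < z := iterate_sqrt_pos k hx
  have hlz : Real.log z = Real.log x / 2 ^ k := log_iterate_sqrt k hx
  have hu : |Real.log z| ≤ 1 / 4 := by
    rw [hlz, abs_div, abs_of_pos h2k, div_le_iff₀ h2k]; linarith
  have hs : |z - 1| ≤ 2 * |Real.log z| := by
    have := Real.abs_exp_sub_one_le (x := Real.log z) (by linarith)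
    rwa [Real.exp_log hz0] at this
  have h1 := abs_log_sub_quadLog_le m (x := z) (by linarith)
  have h3 : approxLog m k x - Real.log x = -(2 ^ k * (Real.log z - quadLog m z)) := by
    rw [approxLog, ← hz, hlz]; field_simp; ring
  rw [h3, abs_neg, abs_mul, abs_of_pos h2k]
  refine mul_le_mul_of_nonneg_left (h1.trans ?_) h2k.le
  refine pow_le_pow_left₀ (by positivity) ?_ _
  have h4 : |Real.log z| = |Real.log x| / 2 ^ k := by rw [hlz, abs_div, abs_of_pos h2k]
  rw [h4] at hs
  calc 2 * |z - 1| ≤ 2 * (2 * (|Real.log x| / 2 ^ k)) := by linarith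
    _ = 4 * |Real.log x| / 2 ^ k := by ring

/-- One node suffices, since the error is then `O(4^(-k))`. This limit carries operator inequalities
from `approxLog` to `ln`. -/
theorem tendsto_approxLog {x : ℝ} (hx : 0 < x) :
    Filter.Tendsto (fun k => approxLog 1 k x) Filter.atTop (𝓝 (Real.log x)) := by
  rw [tendsto_iff_norm_sub_tendsto_zero]
  have hlim : Filter.Tendsto (fun k : ℕ => (4 * |Real.log x|) ^ 3 * (1 / 4 : ℝ) ^ k)
      Filter.atTop (𝓝 0) := by
    have := (tendsto_pow_atTop_nhds_zero_of_lt_one (r := (1 / 4 : ℝ)) (by norm_num)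
      (by norm_num)).const_mul ((4 * |Real.log x|) ^ 3)
    simpa using this
  refine squeeze_zero' (Filter.Eventually.of_forall fun _ => norm_nonneg _) ?_ hlim
  have hev := (tendsto_pow_atTop_atTop_of_one_lt (r := (2 : ℝ)) one_lt_two).eventually_ge_atTop
    (4 * |Real.log x|)
  filter_upwards [hev] with k hk
  refine (abs_approxLog_sub_log_le 1 k hx hk).trans (le_of_eq ?_)
  have : (4 : ℝ) ^ k = 2 ^ k * 2 ^ k := by rw [← mul_pow]; norm_num
  rw [one_div, inv_pow, this, div_pow]
  field_simp
  ring

theorem four_mul_sq_add_le (n c : ℕ) : 4 * (n ^ 2 + c) ≤ 2 ^ (2 * n + (c + 3)) := by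
  have h1 : n ^ 2 ≤ (2 ^ n) ^ 2 := Nat.pow_le_pow_left n.lt_two_pow_self.le 2
  have h2 : c ≤ 2 ^ c := c.lt_two_pow_self.le
  have h3 : 1 ≤ 2 ^ c := Nat.one_le_two_pow
  have h4 : 1 ≤ (2 ^ n) ^ 2 := Nat.one_le_pow _ _ (by positivity)
  have h5 : 2 ^ (2 * n + (c + 3)) = 8 * ((2 ^ n) ^ 2 * 2 ^ c) := by
    rw [pow_add, pow_add, ← pow_mul, mul_comm n 2]; ring
  rw [h5]
  nlinarith [Nat.mul_le_mul h1 h3, Nat.mul_le_mul h4 h2]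

/-- Quadrature sizes of order `√(log (1 / ε))` achieve accuracy `ε` wherever `|log x|` exceeds
`log (1 / ε)` by at most a constant. -/
theorem exists_approxLog_params (a : ℝ) :
    ∃ m k : ℝ → ℕ,
      (fun ε : ℝ => ((m ε + k ε : ℕ) : ℝ)) =O[𝓝[>] 0]
        (fun ε : ℝ => Real.sqrt (Real.log (1 / ε))) ∧
      ∀ ε : ℝ, 0 < ε → 0 < m ε ∧ ∀ x : ℝ, 0 < x →
        |Real.log x| ≤ Real.log (1 / min ε 1) + a →
        |approxLog (m ε) (k ε) x - Real.log x| ≤ min ε 1 / 2 := by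
  obtain ⟨c, hc⟩ := exists_nat_ge a
  set n : ℝ → ℕ := fun ε => ⌈Real.sqrt (Real.log (1 / ε))⌉₊ + 1 with hn
  -- With `N = n ε` and `e = c + 3`, one has `4|ln x| ≤ 4(N² + c) ≤ 2^(2N+e)`, so `k = 4N + e` makes
  -- the ratio `4|ln x|/2^k` at most `2^(-2N)`. Raising it to the power `2m + 1` with `m = N + e`
  -- absorbs the prefactor `2^k` and leaves `2^(-2N²-1) ≤ exp(-N²)/2`.
  refine ⟨fun ε => n ε + (c + 3), fun ε => 4 * n ε + (c + 3), ?_, ?_⟩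
  · refine IsBigO.of_bound (15 + 2 * (c + 3)) ?_
    have hlim : Filter.Tendsto (fun ε : ℝ => Real.sqrt (Real.log (1 / ε))) (𝓝[>] 0)
        Filter.atTop := by
      refine Real.tendsto_sqrt_atTop.comp (Real.tendsto_log_atTop.comp ?_)
      exact (tendsto_inv_nhdsGT_zero (𝕜 := ℝ)).congr fun x => (one_div x).symm
    filter_upwards [hlim.eventually_ge_atTop 1] with ε hε
    rw [Real.norm_of_nonneg (by positivity), Real.norm_of_nonneg (by positivity)]
    have h1 : (n ε : ℝ) ≤ Real.sqrt (Real.log (1 / ε)) + 2 := by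
      have := (Nat.ceil_lt_add_one (Real.sqrt_nonneg (Real.log (1 / ε)))).le
      simp only [hn]
      push_cast
      linarith
    push_cast
    nlinarith [(Nat.cast_nonneg c : (0 : ℝ) ≤ c)]
  · intro ε hε
    refine ⟨by positivity, fun x hx hlog => ?_⟩
    set N := n ε with hN
    set e := c + 3 with he
    have hN1 : 1 ≤ N := by simp [hN, hn]
    have hmin : 0 < min ε 1 := lt_min hε one_pos
    have hl0 : Real.log (1 / min ε 1) ≤ (N : ℝ) ^ 2 := by
      rcases le_total ε 1 with h | h
      · rw [min_eq_left h]
        have h1 : Real.sqrt (Real.log (1 / ε)) ≤ N := by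
          have := Nat.le_ceil (Real.sqrt (Real.log (1 / ε)))
          simp only [hN, hn]
          push_cast
          linarith
        exact (Real.sqrt_le_left (by positivity)).1 h1
      · rw [min_eq_right h]; simp
    have hb : 4 * |Real.log x| ≤ 2 ^ (2 * N + e) := by
      have h1 : (4 * (N ^ 2 + c) : ℝ) ≤ 2 ^ (2 * N + e) := by
        exact_mod_cast four_mul_sq_add_le N c
      linarith
    have hsplit : (2 : ℝ) ^ (4 * N + e) = 2 ^ (2 * N + e) * 2 ^ (2 * N) := by
      rw [← pow_add]; congr 1; ring
    have hb2 : 4 * |Real.log x| / 2 ^ (4 * N + e) ≤ (2 ^ (2 * N))⁻¹ := by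
      rw [div_le_iff₀ (by positivity), hsplit]
      field_simp
      exact hb
    have hle : 4 * |Real.log x| ≤ 2 ^ (4 * N + e) := by
      refine hb.trans (pow_le_pow_right₀ one_le_two (by omega))
    refine (abs_approxLog_sub_log_le (N + e) (4 * N + e) hx hle).trans ?_
    have h2 : (2 : ℝ) ^ (4 * N + e) * ((2 ^ (2 * N))⁻¹) ^ (2 * (N + e) + 1)
        ≤ (2 ^ (2 * N ^ 2 + 1))⁻¹ := by
      rw [inv_pow, ← pow_mul, ← div_eq_mul_inv, div_le_iff₀ (by positivity),
        le_inv_mul_iff₀ (by positivity), ← pow_add]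
      refine pow_le_pow_right₀ one_le_two ?_
      nlinarith [Nat.mul_le_mul hN1 hN1, Nat.mul_le_mul hN1 (le_refl e),
        Nat.mul_le_mul hN1 (le_refl N)]
    have h3 : (2 ^ (2 * N ^ 2 + 1))⁻¹ ≤ min ε 1 / 2 := by
      rw [pow_succ, mul_inv, div_eq_mul_inv]
      refine mul_le_mul_of_nonneg_right ?_ (by norm_num)
      rw [inv_le_comm₀ (by positivity) hmin, ← one_div, ← Real.exp_log (one_div_pos.2 hmin)]
      calc Real.exp (Real.log (1 / min ε 1)) ≤ Real.exp ((N : ℝ) ^ 2) := Real.exp_le_exp.2 hl0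
        _ = Real.exp 1 ^ (N ^ 2) := by rw [← Real.exp_nat_mul]; push_cast; simp
        _ ≤ 4 ^ (N ^ 2) := by
            refine pow_le_pow_left₀ (Real.exp_pos 1).le ?_ _
            linarith [Real.exp_one_lt_d9]
        _ = 2 ^ (2 * N ^ 2) := by rw [pow_mul]; norm_num
    calc (2 : ℝ) ^ (4 * N + e) * (4 * |Real.log x| / 2 ^ (4 * N + e)) ^ (2 * (N + e) + 1)
        ≤ 2 ^ (4 * N + e) * ((2 ^ (2 * N))⁻¹) ^ (2 * (N + e) + 1) := by gcongr
      _ ≤ _ := h2.trans h3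

end RationalLog

/-! ### Matrix inequalities certifying the approximate logarithm. -/

section OperatorConnection

variable {n ι : Type*} [Fintype ι]

theorem posSemidef_smul_real {A : Matrix n n ℂ} (hA : A.PosSemidef) {c : ℝ} (hc : 0 ≤ c) :
    ((c : ℂ) • A).PosSemidef :=
  hA.smul (by exact_mod_cast hc)

theorem isHermitian_sum_smul {G : ι → Matrix n n ℂ} (hG : ∀ x, (G x).IsHermitian) (a : ι → ℝ) :
    (∑ x, (a x : ℂ) • G x).IsHermitian := by
  simp only [IsHermitian, conjTranspose_sum, conjTranspose_smul, (hG _).eq]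
  simp

theorem fromBlocks_sum {A B C D : ι → Matrix n n ℂ} :
    fromBlocks (∑ x, A x) (∑ x, B x) (∑ x, C x) (∑ x, D x)
      = ∑ x, fromBlocks (A x) (B x) (C x) (D x) := by
  ext (i | i) (j | j) <;> simp [Matrix.sum_apply]

variable [Fintype n] [DecidableEq n]

/-- The linear matrix inequalities certifying that `Θ` lies below the rational approximation of
the logarithmic operator connection of `X` and `Ω`. -/
def IsCertified (m k : ℕ) (X Ω Θ : Matrix n n ℂ) : Prop :=
  ∃ (T : Fin m → Matrix n n ℂ) (Z : Fin (k + 1) → Matrix n n ℂ),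
    (∀ j, (T j).IsHermitian) ∧ (∀ i, (Z i).IsHermitian) ∧
    Z 0 = Ω ∧ ∑ j, (glWeight m j : ℂ) • T j = ((2 : ℂ) ^ k)⁻¹ • Θ ∧
    (∀ i : Fin k, (fromBlocks (Z i.castSucc) (Z i.succ) (Z i.succ) X).PosSemidef) ∧
    (∀ j : Fin m, (fromBlocks
      (Z (Fin.last k) - X - T j) (-((Real.sqrt (glNode m j) : ℂ) • T j))
      (-((Real.sqrt (glNode m j) : ℂ) • T j)) (X - (glNode m j : ℂ) • T j)).PosSemidef)

/-- The block matrix is `e` times the congruence of `G` by the block row `(u, v)`. -/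
theorem posSemidef_fromBlocks_smul {G : Matrix n n ℂ} (hG : G.PosSemidef) {e : ℝ} (he : 0 ≤ e)
    (u v : ℝ) :
    (fromBlocks ((e * u * u : ℂ) • G) ((e * u * v : ℂ) • G) ((e * u * v : ℂ) • G)
      ((e * v * v : ℂ) • G)).PosSemidef := by
  have h := posSemidef_smul_real
    (hG.conjTranspose_mul_mul_same (fromCols ((u : ℂ) • (1 : Matrix n n ℂ)) ((v : ℂ) • (1 : Matrix n n ℂ)))) he
  convert h using 1
  rw [conjTranspose_fromCols_eq_fromRows_conjTranspose, fromRows_mul, fromRows_mul_fromCols,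
    fromBlocks_smul]
  simp only [conjTranspose_smul, conjTranspose_one, smul_mul_assoc, one_mul, mul_smul_comm, mul_one,
    smul_smul, Complex.star_def, Complex.conj_ofReal]
  congr 2 <;> ring

theorem posSemidef_fromBlocks_sum {G : ι → Matrix n n ℂ} (hG : ∀ x, (G x).PosSemidef)
    (e u v : ι → ℝ) (he : ∀ x, 0 ≤ e x) {A B D : Matrix n n ℂ}
    (hA : A = ∑ x, ((e x * u x * u x : ℝ) : ℂ) • G x)
    (hB : B = ∑ x, ((e x * u x * v x : ℝ) : ℂ) • G x)
    (hD : D = ∑ x, ((e x * v x * v x : ℝ) : ℂ) • G x) :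
    (fromBlocks A B B D).PosSemidef := by
  rw [hA, hB, hD, fromBlocks_sum]
  refine posSemidef_sum _ fun x _ => ?_
  have := posSemidef_fromBlocks_smul (hG x) (he x) (u x) (v x)
  push_cast
  exact this

/-- Pointwise rational approximations of the logarithm are certified. -/
theorem isCertified_sum (m k : ℕ) {G : ι → Matrix n n ℂ} (hG : ∀ x, (G x).PosSemidef)
    {w : ι → ℝ} (hw : ∀ x, 0 < w x) :
    IsCertified m k (∑ x, G x) (∑ x, (w x : ℂ) • G x)
      (∑ x, (approxLog m k (w x) : ℂ) • G x) := by
  refine ⟨fun j => ∑ x, (logKernel (glNode m j) (Real.sqrt^[k] (w x)) : ℂ) • G x,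
    fun i => ∑ x, ((Real.sqrt^[(i : ℕ)] (w x) : ℝ) : ℂ) • G x,
    fun j => isHermitian_sum_smul (fun x => (hG x).1) _,
    fun i => isHermitian_sum_smul (fun x => (hG x).1) _, by simp, ?_, fun i => ?_, fun j => ?_⟩
  · simp only [Finset.smul_sum, smul_smul]
    rw [Finset.sum_comm]
    refine Finset.sum_congr rfl fun x _ => ?_
    rw [← Finset.sum_smul, approxLog, quadLog]
    push_cast
    rw [inv_mul_cancel_left₀ (by positivity)]
  · refine posSemidef_fromBlocks_sum hG (fun _ => 1) (fun x => Real.sqrt^[(i : ℕ) + 1] (w x))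
      (fun _ => 1) (fun _ => zero_le_one) ?_ (by simp) (by simp)
    refine Finset.sum_congr rfl fun x _ => ?_
    rw [Function.iterate_succ_apply', one_mul, Real.mul_self_sqrt (iterate_sqrt_pos _ (hw x)).le]
    simp
  · have hpos : ∀ x, 0 < 1 + glNode m j * (Real.sqrt^[k] (w x) - 1) := fun x =>
      one_add_mul_sub_one_pos (Set.Ioo_subset_Icc_self (glNode_mem_Ioo m j))
        (iterate_sqrt_pos k (hw x))
    have ht := Real.mul_self_sqrt (glNode_mem_Ioo m j).1.le
    -- With `z` the `k`-fold root of `w` and `q = 1 + t(z-1)`, the scalar block is `q⁻¹` times the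
    -- rank-one matrix of `(-√t (z-1), 1)`.
    refine posSemidef_fromBlocks_sum hG
      (fun x => (1 + glNode m j * (Real.sqrt^[k] (w x) - 1))⁻¹)
      (fun x => -(Real.sqrt (glNode m j) * (Real.sqrt^[k] (w x) - 1))) (fun _ => 1)
      (fun x => (inv_pos.2 (hpos x)).le) ?_ ?_ ?_
    · rw [← Finset.sum_sub_distrib, ← Finset.sum_sub_distrib]
      refine Finset.sum_congr rfl fun x _ => ?_
      conv_lhs => rw [← one_smul ℂ (G x), smul_smul, ← sub_smul, smul_smul, ← sub_smul]
      congr 1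
      norm_cast
      have := hpos x
      rw [logKernel]
      set q := 1 + glNode m j * (Real.sqrt^[k] (w x) - 1) with hq
      have h1 : Real.sqrt^[k] (w x) - 1 - (Real.sqrt^[k] (w x) - 1) / q
          = q⁻¹ * ((Real.sqrt^[k] (w x) - 1) * (q - 1)) := by field_simp
      rw [mul_one, mul_one, h1, hq]
      linear_combination (-q⁻¹ * (Real.sqrt^[k] (w x) - 1) ^ 2) * ht
    · rw [Finset.smul_sum, ← Finset.sum_neg_distrib]
      refine Finset.sum_congr rfl fun x _ => ?_
      rw [smul_smul, ← neg_smul]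
      congr 1
      norm_cast
      rw [logKernel]
      ring
    · rw [Finset.smul_sum, ← Finset.sum_sub_distrib]
      refine Finset.sum_congr rfl fun x _ => ?_
      conv_lhs => rw [← one_smul ℂ (G x), smul_smul, smul_smul, ← sub_smul]
      congr 1
      norm_cast
      have := hpos x
      rw [logKernel]
      field_simp
      ring

theorem IsCertified.conj {m k : ℕ} {X Ω Θ : Matrix n n ℂ} (h : IsCertified m k X Ω Θ)
    (K : Matrix n n ℂ) : IsCertified m k (Kᴴ * X * K) (Kᴴ * Ω * K) (Kᴴ * Θ * K) := by
  obtain ⟨T, Z, hT, hZ, h0, hs, h1, h2⟩ := h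
  have hconj : ∀ A B D : Matrix n n ℂ, (fromBlocks A B B D).PosSemidef →
      (fromBlocks (Kᴴ * A * K) (Kᴴ * B * K) (Kᴴ * B * K) (Kᴴ * D * K)).PosSemidef := by
    intro A B D hP
    have := hP.conjTranspose_mul_mul_same (fromBlocks K 0 0 K)
    simpa [fromBlocks_conjTranspose, fromBlocks_multiply] using this
  refine ⟨fun j => Kᴴ * T j * K, fun i => Kᴴ * Z i * K,
    fun j => isHermitian_conjTranspose_mul_mul _ (hT j),
    fun i => isHermitian_conjTranspose_mul_mul _ (hZ i), by simp only [h0], ?_, fun i => ?_, fun j => ?_⟩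
  · have := congrArg (fun A => Kᴴ * A * K) hs
    simpa [Finset.mul_sum, Finset.sum_mul] using this
  · exact hconj _ _ _ (h1 i)
  · have := hconj _ _ _ (h2 j)
    simpa [mul_sub, sub_mul] using this

omit [DecidableEq n] in
theorem star_dotProduct_mulVec_eq {A : Matrix n n ℂ} (hA : A.IsHermitian) (x y : n → ℂ) :
    star x ⬝ᵥ (A *ᵥ y) = star (A *ᵥ x) ⬝ᵥ y := by
  rw [star_mulVec, hA.eq, dotProduct_mulVec]

/-- Operator monotonicity of the square root. -/
theorem posSemidef_sub_of_sq {W Z : Matrix n n ℂ} (hW : W.PosSemidef) (hZ : Z.IsHermitian)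
    (h : (W * W - Z * Z).PosSemidef) : (W - Z).PosSemidef := by
  have hH : (W - Z).IsHermitian := hW.1.sub hZ
  rw [hH.posSemidef_iff_eigenvalues_nonneg]
  intro i
  by_contra! hneg
  have hv := hH.mulVec_eigenvectorBasis i
  set l := hH.eigenvalues i with hl
  have hv0 : (hH.eigenvectorBasis i).ofLp ≠ 0 := by
    intro h0
    refine hH.eigenvectorBasis.orthonormal.ne_zero i ?_
    ext j
    exact congrFun h0 j
  set v : n → ℂ := (hH.eigenvectorBasis i).ofLp with hvdef
  have hZv : Z *ᵥ v = W *ᵥ v - (l : ℂ) • v := by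
    rw [sub_mulVec] at hv
    have : W *ᵥ v - l • v = Z *ᵥ v := by rw [← hv]; abel
    rw [← this]
    rfl
  -- On an eigenvector with eigenvalue `l < 0`, the form of `W² - Z²` equals `2 l ⟨v, W v⟩ - l²
  -- ‖v‖²`, which is negative.
  have h1 := h.dotProduct_mulVec_nonneg v
  have h2 := hW.dotProduct_mulVec_nonneg v
  have h3 : 0 < star v ⬝ᵥ v := dotProduct_star_self_pos_iff.2 hv0
  rw [sub_mulVec, dotProduct_sub, ← mulVec_mulVec, ← mulVec_mulVec,
    star_dotProduct_mulVec_eq hW.1, star_dotProduct_mulVec_eq hZ, hZv, star_sub, star_smul,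
    sub_dotProduct, dotProduct_sub, dotProduct_sub, dotProduct_smul,
    ← star_dotProduct_mulVec_eq hW.1 v v,
    smul_dotProduct, smul_dotProduct, dotProduct_smul] at h1
  have h1' := (Complex.le_def.1 h1).1
  have h2' := (Complex.le_def.1 h2).1
  have h3' := (Complex.lt_def.1 h3).1
  simp only [smul_eq_mul, Complex.star_def, Complex.conj_ofReal, Complex.sub_re, Complex.re_ofReal_mul,
    Complex.zero_re] at h1' h2' h3'
  have hl0 : l < 0 := hneg
  nlinarith [mul_nonneg (neg_nonneg.2 hl0.le) h2', mul_pos (mul_pos_of_neg_of_neg hl0 hl0) h3']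

theorem posSemidef_sub_sq_of_fromBlocks {A Z : Matrix n n ℂ} (hZ : Z.IsHermitian)
    (h : (fromBlocks A Z Z 1).PosSemidef) : (A - Z * Z).PosSemidef := by
  have : Invertible (1 : Matrix n n ℂ) := invertibleOne
  have := (PosDef.fromBlocks₂₂ A Z (PosDef.one (n := n) (R := ℂ))).1 (by rwa [hZ.eq])
  simpa [hZ.eq] using this

omit [Fintype n] in
theorem posSemidef_diagonal_ofReal {y : n → ℝ} (hy : ∀ i, 0 ≤ y i) :
    (diagonal fun i => (y i : ℂ)).PosSemidef :=
  PosSemidef.diagonal fun i => Complex.zero_le_real.2 (hy i)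

/-- The quadrature constraint bounds `T` by the rational function `logKernel t`. -/
theorem posSemidef_logKernel_sub {Z T : Matrix n n ℂ} {z : n → ℝ} {t : ℝ}
    (ht : t ∈ Set.Icc (0 : ℝ) 1) (hz : ∀ i, 0 < z i)
    (hZ : ((diagonal fun i => (z i : ℂ)) - Z).PosSemidef)
    (h : (fromBlocks (Z - 1 - T) (-((Real.sqrt t : ℂ) • T)) (-((Real.sqrt t : ℂ) • T))
      (1 - (t : ℂ) • T)).PosSemidef) :
    ((diagonal fun i => (logKernel t (z i) : ℂ)) - T).PosSemidef := by
  -- Compressing the block inequality by the column `(d, f)` leaves exactly `-T`, because `d + √t f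
  -- = 1`. The other terms, after replacing `Z` by its upper bound, give `d²(z-1) + f² = logKernel t
  -- z`.
  set d : n → ℝ := fun i => (1 + t * (z i - 1))⁻¹ with hd
  set f : n → ℝ := fun i => Real.sqrt t * (z i - 1) * (1 + t * (z i - 1))⁻¹ with hf
  have h1 := h.conjTranspose_mul_mul_same
    (fromRows (diagonal fun i => (d i : ℂ)) (diagonal fun i => (f i : ℂ)))
  have h2 := hZ.conjTranspose_mul_mul_same (diagonal fun i => (d i : ℂ))
  convert h1.add h2 using 1
  rw [conjTranspose_fromRows_eq_fromCols_conjTranspose, fromCols_mul_fromBlocks,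
    fromCols_mul_fromRows]
  have hone : ∀ i, (d i + Real.sqrt t * f i : ℝ) = 1 := by
    intro i
    have hq := (one_add_mul_sub_one_pos ht (hz i)).ne'
    have hs := Real.mul_self_sqrt ht.1
    simp only [hd, hf]
    field_simp
    linear_combination (z i - 1) * hs
  have hker : ∀ i, d i * (z i - 1) * d i + f i * f i = logKernel t (z i) := by
    intro i
    have hq := (one_add_mul_sub_one_pos ht (hz i)).ne'
    have hs := Real.mul_self_sqrt ht.1
    simp only [hd, hf, logKernel]
    field_simp
    linear_combination (z i - 1) ^ 2 * hs
  ext i j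
  have e1 : (d i : ℂ) = 1 - Real.sqrt t * f i := by
    have := congrArg (fun r : ℝ => (r : ℂ)) (hone i)
    push_cast at this
    linear_combination this
  have e2 : (d j : ℂ) = 1 - Real.sqrt t * f j := by
    have := congrArg (fun r : ℝ => (r : ℂ)) (hone j)
    push_cast at this
    linear_combination this
  have hs : (Real.sqrt t : ℂ) * Real.sqrt t = t := by
    exact_mod_cast Real.mul_self_sqrt ht.1
  simp only [diagonal_conjTranspose, Matrix.add_apply, Matrix.sub_apply, Matrix.mul_diagonal,
    Matrix.diagonal_mul, Matrix.neg_apply, Matrix.smul_apply, smul_eq_mul, Pi.star_apply,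
    Complex.star_def, Complex.conj_ofReal, add_mul]
  by_cases hij : i = j
  · subst hij
    have hk := congrArg (fun r : ℝ => (r : ℂ)) (hker i)
    push_cast at hk
    simp only [diagonal_apply_eq, one_apply_eq]
    rw [← hk, ← hs, e1]
    ring
  · simp only [diagonal_apply_ne _ hij, one_apply_ne hij]
    rw [← hs, e1, e2]
    ring

/-- Schur complements give `Z (i+1)² ≤ Z i`, so by induction and operator monotonicity of the square
root each `Z i` is below the `i`-fold root of `y`. The positive weights then add up the bounds on
the `T j`. -/
theorem IsCertified.posSemidef_diagonal_sub {m k : ℕ} {y : n → ℝ} (hy : ∀ i, 0 < y i)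
    {Θ : Matrix n n ℂ} (h : IsCertified m k 1 (diagonal fun i => (y i : ℂ)) Θ) :
    ((diagonal fun i => (approxLog m k (y i) : ℂ)) - Θ).PosSemidef := by
  obtain ⟨T, Z, hT, hZ, h0, hs, h1, h2⟩ := h
  have hroot : ∀ i : Fin (k + 1),
      ((diagonal fun l => ((Real.sqrt^[(i : ℕ)] (y l) : ℝ) : ℂ)) - Z i).PosSemidef := by
    intro i
    induction i using Fin.induction with
    | zero => simpa [h0] using PosSemidef.zero (n := n) (R := ℂ)
    | succ i ih =>
      refine posSemidef_sub_of_sq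
        (posSemidef_diagonal_ofReal fun l => (iterate_sqrt_pos _ (hy l)).le) (hZ _) ?_
      have h3 := ih.add (posSemidef_sub_sq_of_fromBlocks (hZ _) (h1 i))
      rw [sub_add_sub_cancel] at h3
      convert h3 using 2
      rw [diagonal_mul_diagonal]
      congr 1
      funext l
      rw [Fin.val_succ, Function.iterate_succ_apply', Fin.val_castSucc]
      exact_mod_cast Real.mul_self_sqrt (iterate_sqrt_pos _ (hy l)).le
  have h3 : (∑ j, (glWeight m j : ℂ) • ((diagonal fun l =>
      (logKernel (glNode m j) (Real.sqrt^[k] (y l)) : ℂ)) - T j)).PosSemidef := by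
    refine posSemidef_sum _ fun j _ => posSemidef_smul_real ?_ (glWeight_pos m j).le
    exact posSemidef_logKernel_sub (Set.Ioo_subset_Icc_self (glNode_mem_Ioo m j))
      (fun l => iterate_sqrt_pos k (hy l)) (by simpa using hroot (Fin.last k)) (h2 j)
  have h4 := posSemidef_smul_real h3 (c := 2 ^ k) (by positivity)
  convert h4 using 1
  simp only [smul_sub, Finset.sum_sub_distrib, hs]
  congr 1
  · rw [Finset.smul_sum]
    ext i j
    by_cases hij : i = j
    · subst hij
      simp [Matrix.sum_apply, approxLog, quadLog, Finset.mul_sum]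
    · simp [Matrix.sum_apply, hij]
  · rw [smul_smul]
    push_cast
    rw [mul_inv_cancel₀ (by positivity), one_smul]

/-- A certified `Θ` lies below the rational approximation of the logarithmic connection. -/
theorem IsCertified.posSemidef_sub {m k : ℕ} {J Θ : Matrix n n ℂ} (hJ : IsUnit J)
    {y : n → ℝ} (hy : ∀ i, 0 < y i)
    (h : IsCertified m k (Jᴴ * J) (Jᴴ * (diagonal fun i => (y i : ℂ)) * J) Θ) :
    (Jᴴ * (diagonal fun i => (approxLog m k (y i) : ℂ)) * J - Θ).PosSemidef := by
  have hdet : IsUnit J.det := (isUnit_iff_isUnit_det J).1 hJ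
  have hl : J * J⁻¹ = 1 := mul_nonsing_inv J hdet
  have hr : J⁻¹ * J = 1 := nonsing_inv_mul J hdet
  have hl' : J⁻¹ᴴ * Jᴴ = 1 := by rw [← conjTranspose_mul, hl, conjTranspose_one]
  have hr' : Jᴴ * J⁻¹ᴴ = 1 := by rw [← conjTranspose_mul, hr, conjTranspose_one]
  -- Certificates are invariant under congruence, which reduces to identity `X` and diagonal `Ω`.
  have h1 := h.conj J⁻¹
  have e1 : J⁻¹ᴴ * (Jᴴ * J) * J⁻¹ = 1 := by
    rw [← mul_assoc, hl', one_mul, hl]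
  have e2 : ∀ D : Matrix n n ℂ, J⁻¹ᴴ * (Jᴴ * D * J) * J⁻¹ = D := by
    intro D
    rw [mul_assoc Jᴴ, ← mul_assoc J⁻¹ᴴ, hl', one_mul, mul_assoc, hl, mul_one]
  rw [e1, e2] at h1
  have h2 := (h1.posSemidef_diagonal_sub hy).conjTranspose_mul_mul_same J
  convert h2 using 1
  rw [mul_sub, sub_mul]
  congr 1
  rw [mul_assoc, mul_assoc (J⁻¹ᴴ * Θ), hr, mul_one, ← mul_assoc, hr', one_mul]

end OperatorConnection

/-! ### Joint diagonalization, operator Jensen inequality, domination. -/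

section JointDiagonalization

variable {n ι : Type*} [Fintype n] [DecidableEq n] [Fintype ι]

theorem isHermitian_cfc_sqrt (X : Matrix n n ℂ) : (cfc Real.sqrt X).IsHermitian :=
  cfc_predicate Real.sqrt X

theorem cfc_sqrt_mul_self {X : Matrix n n ℂ} (hX : X.PosSemidef) :
    cfc Real.sqrt X * cfc Real.sqrt X = X := by
  have hs : IsSelfAdjoint X := hX.1
  rw [← cfc_mul Real.sqrt Real.sqrt X]
  conv_rhs => rw [← cfc_id' ℝ X]
  refine cfc_congr fun x hx => ?_
  refine Real.mul_self_sqrt ?_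
  rw [hX.1.spectrum_real_eq_range_eigenvalues] at hx
  obtain ⟨i, rfl⟩ := hx
  exact hX.eigenvalues_nonneg i

theorem exists_unitary_cfc_eq {Y : Matrix n n ℂ} (hY : Y.IsHermitian) :
    ∃ U : Matrix n n ℂ, U * Uᴴ = 1 ∧ Uᴴ * U = 1 ∧
      (Y = U * (diagonal fun i => (hY.eigenvalues i : ℂ)) * Uᴴ) ∧
      ∀ f : ℝ → ℝ, cfc f Y = U * (diagonal fun i => (f (hY.eigenvalues i) : ℂ)) * Uᴴ := by
  refine ⟨hY.eigenvectorUnitary, ?_, ?_, ?_, fun f => ?_⟩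
  · exact Unitary.coe_mul_star_self hY.eigenvectorUnitary
  · exact Unitary.coe_star_mul_self hY.eigenvectorUnitary
  · have := hY.spectral_theorem
    rw [Unitary.conjStarAlgAut_apply] at this
    exact this
  · rw [hY.cfc_eq, IsHermitian.cfc, Unitary.conjStarAlgAut_apply]
    rfl

/-- Two positive definite matrices are simultaneously diagonalized by a congruence, which also
diagonalizes their logarithmic operator connection. -/
theorem exists_joint_diagonalization {X Y : Matrix n n ℂ} (hX : X.PosDef) (hY : Y.PosDef) :
    ∃ (J : Matrix n n ℂ) (y : n → ℝ), IsUnit J ∧ (∀ i, 0 < y i) ∧ X = Jᴴ * J ∧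
      Y = Jᴴ * (diagonal fun i => (y i : ℂ)) * J ∧
      logPerspective X Y = Jᴴ * (diagonal fun i => (Real.log (y i) : ℂ)) * J := by
  have hS := isHermitian_cfc_sqrt X
  have hSS := cfc_sqrt_mul_self hX.posSemidef
  rw [logPerspective]
  set S := cfc Real.sqrt X
  have hSu : IsUnit S := isUnit_of_mul_isUnit_left (hSS ▸ hX.isUnit)
  have hdet : IsUnit S.det := (isUnit_iff_isUnit_det S).1 hSu
  have hSi : S⁻¹ᴴ = S⁻¹ := by rw [conjTranspose_nonsing_inv, hS.eq]
  have hP : (S⁻¹ * Y * S⁻¹).PosDef := by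
    have := (IsUnit.posDef_star_left_conjugate_iff
      ((isUnit_nonsing_inv_iff).2 hSu) (x := Y)).2 hY
    rwa [star_eq_conjTranspose, hSi] at this
  obtain ⟨U, hU1, hU2, hUY, hUf⟩ := exists_unitary_cfc_eq hP.1
  have hUu : IsUnit U := IsUnit.of_mul_eq_one _ hU1
  have hUu' : IsUnit Uᴴ := IsUnit.of_mul_eq_one _ hU2
  -- `S = X^{1/2}` and `U` diagonalizes `S⁻¹ Y S⁻¹`.
  refine ⟨Uᴴ * S, hP.1.eigenvalues, hUu'.mul hSu, hP.eigenvalues_pos, ?_, ?_, ?_⟩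
  · rw [conjTranspose_mul, conjTranspose_conjTranspose, hS.eq, mul_assoc, ← mul_assoc U, hU1,
      one_mul, hSS]
  · rw [conjTranspose_mul, conjTranspose_conjTranspose, hS.eq]
    have h1 : Y = S * (S⁻¹ * Y * S⁻¹) * S := by
      rw [mul_assoc S⁻¹, mul_nonsing_inv_cancel_left _ _ hdet, mul_assoc,
        nonsing_inv_mul _ hdet, mul_one]
    conv_lhs => rw [h1, hUY]
    simp only [mul_assoc]
  · rw [hUf, conjTranspose_mul, conjTranspose_conjTranspose, hS.eq]
    simp only [mul_assoc]

omit [Fintype n] [DecidableEq n] in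
theorem posDef_sum_smul {G : ι → Matrix n n ℂ} (hG : ∀ x, (G x).PosSemidef)
    (hX : (∑ x, G x).PosDef) {w : ι → ℝ} (hw : ∀ x, 0 < w x) :
    (∑ x, (w x : ℂ) • G x).PosDef := by
  obtain ⟨c, hc, hcw⟩ : ∃ c : ℝ, 0 < c ∧ ∀ x, c ≤ w x := by
    cases isEmpty_or_nonempty ι
    · exact ⟨1, one_pos, fun x => isEmptyElim x⟩
    · obtain ⟨x, hx⟩ := Finite.exists_min w
      exact ⟨w x, hw x, hx⟩
  have h1 : ((c : ℂ) • ∑ x, G x).PosDef := hX.smul (Complex.zero_lt_real.2 hc)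
  have h2 : (∑ x, ((w x - c : ℝ) : ℂ) • G x).PosSemidef :=
    posSemidef_sum _ fun x _ => posSemidef_smul_real (hG x) (sub_nonneg.2 (hcw x))
  convert h1.add_posSemidef h2 using 1
  rw [Finset.smul_sum, ← Finset.sum_add_distrib]
  refine Finset.sum_congr rfl fun x _ => ?_
  rw [← add_smul]
  push_cast
  ring_nf

omit [DecidableEq n] in
theorem posSemidef_of_tendsto {M : ℕ → Matrix n n ℂ} {L : Matrix n n ℂ}
    (hM : ∀ k, (M k).PosSemidef) (h : Filter.Tendsto M Filter.atTop (𝓝 L)) : L.PosSemidef := by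
  refine PosSemidef.of_dotProduct_mulVec_nonneg ?_ fun v => ?_
  · have h1 : Filter.Tendsto (fun k => (M k)ᴴ) Filter.atTop (𝓝 Lᴴ) :=
      (Continuous.tendsto (by fun_prop) L).comp h
    have h2 : (fun k => (M k)ᴴ) = M := funext fun k => (hM k).1.eq
    rw [h2] at h1
    exact tendsto_nhds_unique h1 h
  · have h1 : Filter.Tendsto (fun k => star v ⬝ᵥ (M k *ᵥ v)) Filter.atTop
        (𝓝 (star v ⬝ᵥ (L *ᵥ v))) :=
      (Continuous.tendsto (f := fun N : Matrix n n ℂ => star v ⬝ᵥ (N *ᵥ v)) (by fun_prop) L).comp h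
    exact ge_of_tendsto' h1 fun k => (hM k).dotProduct_mulVec_nonneg v

/-- Operator Jensen inequality for the logarithm, in homogeneous form. -/
theorem posSemidef_logPerspective_sub_sum {G : ι → Matrix n n ℂ} (hG : ∀ x, (G x).PosSemidef)
    (hX : (∑ x, G x).PosDef) {w : ι → ℝ} (hw : ∀ x, 0 < w x) :
    (logPerspective (∑ x, G x) (∑ x, (w x : ℂ) • G x)
      - ∑ x, (Real.log (w x) : ℂ) • G x).PosSemidef := by
  obtain ⟨J, y, hJ, hy, hXJ, hYJ, hlog⟩ :=
    exists_joint_diagonalization hX (posDef_sum_smul hG hX hw)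
  rw [hlog]
  -- At each `k` the sum over `w` is certified, hence lies below the same function of the joint
  -- eigenvalues `y`; Jensen's inequality is the limit.
  refine posSemidef_of_tendsto (M := fun k =>
    Jᴴ * (diagonal fun i => (approxLog 1 k (y i) : ℂ)) * J
      - ∑ x, (approxLog 1 k (w x) : ℂ) • G x) (fun k => ?_) ?_
  · refine IsCertified.posSemidef_sub hJ hy ?_
    rw [← hXJ, ← hYJ]
    exact isCertified_sum 1 k hG hw
  · have hc : ∀ {x : ℝ}, 0 < x → Filter.Tendsto (fun k => (approxLog 1 k x : ℂ)) Filter.atTop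
        (𝓝 (Real.log x : ℂ)) := fun hx =>
      (Complex.continuous_ofReal.tendsto _).comp (tendsto_approxLog hx)
    refine Filter.Tendsto.sub ?_ (tendsto_finsetSum _ fun x _ => (hc (hw x)).smul_const _)
    have h1 : Filter.Tendsto (fun k : ℕ => fun i => (approxLog 1 k (y i) : ℂ)) Filter.atTop
        (𝓝 fun i => (Real.log (y i) : ℂ)) := tendsto_pi_nhds.2 fun i => hc (hy i)
    exact (Continuous.tendsto (f := fun d : n → ℂ => Jᴴ * diagonal d * J) (by fun_prop) _).comp h1

theorem posSemidef_trace_smul_one_sub {A : Matrix n n ℂ} (hA : A.PosSemidef) :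
    (((A.trace.re : ℝ) : ℂ) • (1 : Matrix n n ℂ) - A).PosSemidef := by
  obtain ⟨U, hU1, hU2, hUA, -⟩ := exists_unitary_cfc_eq hA.1
  have htr : A.trace.re = ∑ i, hA.1.eigenvalues i := by
    rw [hA.1.trace_eq_sum_eigenvalues]
    simp
  have h1 : (diagonal fun i => ((A.trace.re - hA.1.eigenvalues i : ℝ) : ℂ)).PosSemidef := by
    refine posSemidef_diagonal_ofReal fun i => ?_
    rw [htr, sub_nonneg]
    exact Finset.single_le_sum (fun j _ => hA.eigenvalues_nonneg j) (Finset.mem_univ i)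
  convert h1.mul_mul_conjTranspose_same U using 1
  have h2 : (diagonal fun i => ((A.trace.re - hA.1.eigenvalues i : ℝ) : ℂ))
      = ((A.trace.re : ℝ) : ℂ) • (1 : Matrix n n ℂ)
        - diagonal fun i => (hA.1.eigenvalues i : ℂ) := by
    ext i j
    by_cases hij : i = j
    · subst hij; simp
    · simp [hij]
  rw [h2, mul_sub, sub_mul, ← hUA, mul_smul_comm, mul_one, smul_mul_assoc, hU1]

/-- A positive semidefinite matrix is dominated by a multiple of any other one whose kernel it
annihilates. -/
theorem exists_posSemidef_smul_sub {A B : Matrix n n ℂ} (hA : A.PosSemidef) (hB : B.PosSemidef)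
    (hker : ∀ v : n → ℂ, star v ⬝ᵥ (B *ᵥ v) = 0 → star v ⬝ᵥ (A *ᵥ v) = 0) :
    ∃ C : ℝ, 0 < C ∧ ((C : ℂ) • B - A).PosSemidef := by
  obtain ⟨U, hU1, hU2, hUB, -⟩ := exists_unitary_cfc_eq hB.1
  set l := hB.1.eigenvalues with hl
  have hl0 : ∀ i, 0 ≤ l i := hB.eigenvalues_nonneg
  obtain ⟨F, hF⟩ : ∃ F : Matrix n n ℂ, A = Fᴴ * F := by
    refine ⟨cfc Real.sqrt A, ?_⟩
    rw [(isHermitian_cfc_sqrt A).eq, cfc_sqrt_mul_self hA]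
  have hcol : ∀ i, l i = 0 → ∀ j, (F * U) j i = 0 := by
    intro i hi j
    have hv : star (U *ᵥ Pi.single i 1) ⬝ᵥ (B *ᵥ (U *ᵥ Pi.single i 1)) = 0 := by
      rw [star_mulVec, ← dotProduct_mulVec, mulVec_mulVec, mulVec_mulVec]
      have : Uᴴ * B * U = diagonal fun i => (l i : ℂ) := by
        rw [hUB, mul_assoc, mul_assoc, hU2, mul_one, ← mul_assoc, hU2, one_mul]
      rw [this]
      simp [hi]
    have h2 := hker _ hv
    rw [hF, ← mulVec_mulVec, dotProduct_mulVec, ← star_mulVec,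
      dotProduct_star_self_eq_zero, mulVec_mulVec] at h2
    simpa using congrFun h2 j
  -- Since `0⁻¹ = 0`, `V` drops the kernel of `B`, where the columns of `F U` vanish anyway. So `F =
  -- V √l Uᴴ` and `A ≤ Tr[Vᴴ V] B`.
  set μ : n → ℝ := fun i => (Real.sqrt (l i))⁻¹ with hμ
  set V : Matrix n n ℂ := F * U * (diagonal fun i => (μ i : ℂ)) with hV
  have hFU : F * U = V * (diagonal fun i => (Real.sqrt (l i) : ℂ)) := by
    ext j i
    rw [hV, mul_diagonal, mul_diagonal]
    by_cases hi : l i = 0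
    · rw [hcol i hi j]; simp
    · have : (Real.sqrt (l i) : ℂ) ≠ 0 := by
        exact_mod_cast (Real.sqrt_pos.2 (lt_of_le_of_ne (hl0 i) (Ne.symm hi))).ne'
      rw [hμ]
      push_cast
      field_simp
  set C := (Vᴴ * V).trace.re with hC
  have hVV := posSemidef_conjTranspose_mul_self V
  have hC0 : 0 ≤ C := (Complex.le_def.1 hVV.trace_nonneg).1
  have h1 := (posSemidef_trace_smul_one_sub hVV).conjTranspose_mul_mul_same
    ((diagonal fun i => (Real.sqrt (l i) : ℂ)) * Uᴴ)
  have hD : (diagonal fun i => (Real.sqrt (l i) : ℂ))ᴴ = diagonal fun i => (Real.sqrt (l i) : ℂ) := by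
    rw [diagonal_conjTranspose]
    congr 1
    funext i
    simp
  have hDD : (diagonal fun i => (Real.sqrt (l i) : ℂ)) * (diagonal fun i => (Real.sqrt (l i) : ℂ))
      = diagonal fun i => (l i : ℂ) := by
    rw [diagonal_mul_diagonal]
    congr 1
    funext i
    exact_mod_cast Real.mul_self_sqrt (hl0 i)
  refine ⟨C + 1, by linarith, ?_⟩
  have h2 := h1.add hB
  convert h2 using 1
  have hA' : A = U * (diagonal fun i => (Real.sqrt (l i) : ℂ)) * (Vᴴ * V)
      * ((diagonal fun i => (Real.sqrt (l i) : ℂ)) * Uᴴ) := by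
    have e1 : F = V * (diagonal fun i => (Real.sqrt (l i) : ℂ)) * Uᴴ := by
      rw [← hFU, mul_assoc, hU1, mul_one]
    rw [hF]
    conv_lhs => rw [e1]
    rw [conjTranspose_mul, conjTranspose_mul, hD, conjTranspose_conjTranspose]
    simp only [mul_assoc]
  rw [conjTranspose_mul, hD, conjTranspose_conjTranspose, mul_sub, sub_mul, ← hA', ← hC,
    mul_smul_comm, mul_one, smul_mul_assoc, mul_assoc U,
    ← mul_assoc (diagonal fun i => (Real.sqrt (l i) : ℂ)), hDD, ← mul_assoc U, ← hUB]
  push_cast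
  rw [add_smul, one_smul]
  abel

theorem re_trace_mul_nonneg {A B : Matrix n n ℂ} (hA : A.PosSemidef) (hB : B.PosSemidef) :
    0 ≤ (A * B).trace.re := by
  have h := hB.conjTranspose_mul_mul_same (cfc Real.sqrt A)
  rw [(isHermitian_cfc_sqrt A).eq] at h
  have h1 := (Complex.le_def.1 h.trace_nonneg).1
  rwa [trace_mul_cycle, cfc_sqrt_mul_self hA] at h1

end JointDiagonalization

/-! ### Choi operators and maps acting on part of a state. -/

section ChoiOperator

variable {A B R : Type*} [Fintype A] [DecidableEq A]

theorem maxEntangled_apply (i j a a' : A) :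
    maxEntangled A (i, a) (j, a') = single i j 1 a a' := by
  simp only [maxEntangled, Matrix.sum_apply, kronecker_apply]
  rw [Finset.sum_eq_single i, Finset.sum_eq_single j]
  · simp
  · intro k _ hk; simp [single_apply, hk]
  · simp
  · intro k _ hk; simp [single_apply, hk]
  · simp

theorem choi_apply (Φ : Matrix A A ℂ →ₗ[ℂ] Matrix B B ℂ) (i j : A) (b b' : B) :
    choi Φ (i, b) (j, b') = Φ (single i j 1) b b' := by
  have h : (fun a a' => maxEntangled A (i, a) (j, a')) = single i j (1 : ℂ) :=
    funext fun a => funext fun a' => maxEntangled_apply i j a a'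
  rw [choi]
  exact congrArg (fun Y => Φ Y b b') h

theorem posSemidef_maxEntangled : (maxEntangled A).PosSemidef := by
  have h := posSemidef_vecMulVec_self_star (fun p : A × A => if p.1 = p.2 then (1 : ℂ) else 0)
  convert h using 1
  ext ⟨i, a⟩ ⟨j, a'⟩
  rw [maxEntangled_apply, single_apply, vecMulVec_apply]
  by_cases h1 : i = a <;> by_cases h2 : j = a' <;> simp [h1, h2]

theorem posSemidef_choi {Φ : Matrix A A ℂ →ₗ[ℂ] Matrix B B ℂ} (hΦ : IsCompletelyPositive Φ) :
    (choi Φ).PosSemidef := by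
  have e := Fintype.equivFin A
  have h := hΦ (Fintype.card A) _
    (posSemidef_maxEntangled.submatrix (fun p : Fin (Fintype.card A) × A => (e.symm p.1, p.2)))
  have h2 := h.submatrix (fun p : A × B => (e p.1, p.2))
  convert h2 using 1
  ext ⟨i, b⟩ ⟨j, b'⟩
  simp [choi, idTensor]

theorem apply_eq_sum_choi (Φ : Matrix A A ℂ →ₗ[ℂ] Matrix B B ℂ) (Y : Matrix A A ℂ) (b b' : B) :
    Φ Y b b' = ∑ i, ∑ j, Y i j * choi Φ (i, b) (j, b') := by
  conv_lhs => rw [matrix_eq_sum_single Y]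
  simp only [map_sum, Matrix.sum_apply]
  refine Finset.sum_congr rfl fun i _ => Finset.sum_congr rfl fun j _ => ?_
  have h : single i j (Y i j) = Y i j • single i j (1 : ℂ) := by simp
  rw [choi_apply, h, map_smul, Matrix.smul_apply, smul_eq_mul]

variable [Fintype B] [DecidableEq B] {S : Type*} [Fintype S]

/-- The operator on `RA` with amplitude matrices `K s`. -/
def ofAmplitudes (K : S → Matrix R A ℂ) : Matrix (R × A) (R × A) ℂ :=
  fun p q => ∑ s, K s p.1 p.2 * star (K s q.1 q.2)

theorem idTensor_ofAmplitudes (Φ : Matrix A A ℂ →ₗ[ℂ] Matrix B B ℂ) (K : S → Matrix R A ℂ) :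
    idTensor Φ (ofAmplitudes K)
      = ∑ s, (K s ⊗ₖ (1 : Matrix B B ℂ)) * choi Φ * (K s ⊗ₖ (1 : Matrix B B ℂ))ᴴ := by
  ext ⟨r, b⟩ ⟨r', b'⟩
  have h0 : idTensor Φ (ofAmplitudes K) (r, b) (r', b')
      = Φ (fun a a' => ∑ s, K s r a * star (K s r' a')) b b' := rfl
  rw [h0]
  refine (apply_eq_sum_choi Φ (Matrix.of fun a a' => ∑ s, K s r a * star (K s r' a')) b b').trans ?_
  rw [Matrix.sum_apply]
  simp only [of_apply, Finset.sum_mul]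
  rw [Finset.sum_congr rfl fun i _ => Finset.sum_comm, Finset.sum_comm]
  refine Finset.sum_congr rfl fun s _ => ?_
  simp only [mul_apply, Fintype.sum_prod_type, conjTranspose_apply, kronecker_apply, one_apply,
    mul_ite, mul_one, mul_zero, ite_mul, zero_mul, apply_ite star, star_zero, Finset.sum_ite_eq,
    Finset.mem_univ, if_true]
  simp only [Finset.sum_mul]
  rw [Finset.sum_comm]
  refine Finset.sum_congr rfl fun i _ => Finset.sum_congr rfl fun j _ => ?_
  ring

theorem trace_mul_idTensor_ofAmplitudes [Fintype R] (Φ : Matrix A A ℂ →ₗ[ℂ] Matrix B B ℂ)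
    (K : S → Matrix R A ℂ) (L : Matrix (R × B) (R × B) ℂ) :
    (L * idTensor Φ (ofAmplitudes K)).trace
      = ((∑ s, (K s ⊗ₖ (1 : Matrix B B ℂ))ᴴ * L * (K s ⊗ₖ (1 : Matrix B B ℂ))) * choi Φ).trace := by
  rw [idTensor_ofAmplitudes, Finset.mul_sum, Finset.sum_mul, trace_sum, trace_sum]
  refine Finset.sum_congr rfl fun s _ => ?_
  rw [← Matrix.mul_assoc, trace_mul_comm, ← Matrix.mul_assoc, ← Matrix.mul_assoc]

omit [Fintype A] [DecidableEq A] in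
-- This is the source of the transpose in the energy constraint.
theorem transpose_sum_conjTranspose_mul [Fintype R] (K : S → Matrix R A ℂ) :
    (∑ s, (K s)ᴴ * K s)ᵀ = partialTraceLeft (ofAmplitudes K) := by
  ext a a'
  simp only [transpose_apply, Matrix.sum_apply, mul_apply, conjTranspose_apply, partialTraceLeft,
    ofAmplitudes]
  rw [Finset.sum_comm]
  exact Finset.sum_congr rfl fun r _ => Finset.sum_congr rfl fun s _ => mul_comm _ _

omit [DecidableEq A] in
theorem trace_partialTraceLeft [Fintype R] (X : Matrix (R × A) (R × A) ℂ) :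
    (partialTraceLeft X).trace = X.trace := by
  simp only [trace, partialTraceLeft, diag_apply, Fintype.sum_prod_type]
  exact Finset.sum_comm

omit [Fintype A] [DecidableEq A] in
theorem posSemidef_ofAmplitudes [Finite R] [Finite A] (K : S → Matrix R A ℂ) :
    (ofAmplitudes K).PosSemidef := by
  have h := posSemidef_self_mul_conjTranspose (Matrix.of fun (p : R × A) (s : S) => K s p.1 p.2)
  exact h

theorem exists_eq_ofAmplitudes [Fintype R] [DecidableEq R] {X : Matrix (R × A) (R × A) ℂ}
    (hX : X.PosSemidef) : ∃ K : R × A → Matrix R A ℂ, X = ofAmplitudes K := by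
  refine ⟨fun s r a => cfc Real.sqrt X (r, a) s, ?_⟩
  have h := cfc_sqrt_mul_self hX
  conv_lhs => rw [← h]
  nth_rw 2 [← (isHermitian_cfc_sqrt X).eq]
  rfl

omit [Fintype A] [DecidableEq A] [Fintype B] in
theorem sum_kronecker_one (ρ : S → Matrix A A ℂ) :
    ∑ s, ρ s ⊗ₖ (1 : Matrix B B ℂ) = (∑ s, ρ s) ⊗ₖ (1 : Matrix B B ℂ) := by
  ext ⟨a, b⟩ ⟨a', b'⟩
  simp [Matrix.sum_apply, Finset.sum_mul]

end ChoiOperator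

/-! ### Testers in place of input states and measurements. -/

section Testers

variable {A B X : Type*} [Fintype A] [DecidableEq A] [Fintype B] [DecidableEq B] [Fintype X]

/-- The reduced effects of a measurement of a channel output: positive semidefinite operators which
sum to `ρ ⊗ 1`. -/
def IsTester (ρ : Matrix A A ℂ) (G : X → Matrix (A × B) (A × B) ℂ) : Prop :=
  (∀ x, (G x).PosSemidef) ∧ ∑ x, G x = ρ ⊗ₖ (1 : Matrix B B ℂ)

/-- The normalization and energy constraints on the reference operator `ρ`. -/
def IsFeasible (H : Matrix A A ℂ) (E : ℝ) (ρ : Matrix A A ℂ) : Prop :=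
  ρ.trace = 1 ∧ (H * ρᵀ).trace.re ≤ E

/-- The statistics of a tester on the map `Φ`. -/
noncomputable def outcome (Φ : Matrix A A ℂ →ₗ[ℂ] Matrix B B ℂ)
    (G : X → Matrix (A × B) (A × B) ℂ) (x : X) : ℝ :=
  (G x * choi Φ).trace.re

theorem relEntropy_comp_equiv {Y : Type*} [Fintype Y] (e : Y ≃ X) (p q : X → ℝ) :
    relEntropy (fun y => p (e y)) (fun y => q (e y)) = relEntropy p q := by
  have h1 : (∀ y, q (e y) = 0 → p (e y) = 0) ↔ ∀ x, q x = 0 → p x = 0 :=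
    e.forall_congr_right (q := fun x => q x = 0 → p x = 0)
  have h2 : ∑ y, p (e y) * Real.log (p (e y) / q (e y)) = ∑ x, p x * Real.log (p x / q x) :=
    e.sum_comp fun x => p x * Real.log (p x / q x)
  simp only [relEntropy, h1, h2]

/-- Every measurement of a channel output is described by a tester. -/
theorem exists_isTester {N M : Matrix A A ℂ →ₗ[ℂ] Matrix B B ℂ} {H : Matrix A A ℂ} {E : ℝ}
    {r : ℕ} {σ : Matrix (Fin r × A) (Fin r × A) ℂ} (hσ : IsDensity σ)
    (hE : (H * partialTraceLeft σ).trace.re ≤ E) {L : X → Matrix (Fin r × B) (Fin r × B) ℂ}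
    (hL : IsPOVM L) :
    ∃ (ρ : Matrix A A ℂ) (G : X → Matrix (A × B) (A × B) ℂ), ρ.PosSemidef ∧ IsFeasible H E ρ ∧
      IsTester ρ G ∧ (fun x => (L x * idTensor N σ).trace.re) = outcome N G ∧
      (fun x => (L x * idTensor M σ).trace.re) = outcome M G := by
  obtain ⟨K, rfl⟩ := exists_eq_ofAmplitudes hσ.1
  refine ⟨∑ s, (K s)ᴴ * K s,
    fun x => ∑ s, (K s ⊗ₖ (1 : Matrix B B ℂ))ᴴ * L x * (K s ⊗ₖ (1 : Matrix B B ℂ)),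
    posSemidef_sum _ fun s _ => posSemidef_conjTranspose_mul_self _, ⟨?_, ?_⟩,
    ⟨fun x => posSemidef_sum _ fun s _ => (hL.1 x).conjTranspose_mul_mul_same _, ?_⟩,
    funext fun x => ?_, funext fun x => ?_⟩
  · rw [← trace_transpose, transpose_sum_conjTranspose_mul, trace_partialTraceLeft, hσ.2]
  · rw [transpose_sum_conjTranspose_mul]; exact hE
  · rw [Finset.sum_comm, ← sum_kronecker_one]
    refine Finset.sum_congr rfl fun s _ => ?_
    rw [← Matrix.sum_mul, ← Matrix.mul_sum, hL.2, Matrix.mul_one, conjTranspose_kronecker,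
      conjTranspose_one, ← mul_kronecker_mul, mul_one]
  · rw [trace_mul_idTensor_ofAmplitudes, outcome]
  · rw [trace_mul_idTensor_ofAmplitudes, outcome]

/-- Every tester with invertible `ρ` is realized by a measurement of a channel output. -/
theorem relEntropy_outcome_le {N M : Matrix A A ℂ →ₗ[ℂ] Matrix B B ℂ} {H : Matrix A A ℂ} {E : ℝ}
    {ρ : Matrix A A ℂ} (hρ : ρ.PosDef) (hfeas : IsFeasible H E ρ)
    {G : X → Matrix (A × B) (A × B) ℂ} (hG : IsTester ρ G) :
    relEntropy (outcome N G) (outcome M G) ≤ channelMeasuredRelEntropy N M H E := by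
  set e := Fintype.equivFin A
  set eX := Fintype.equivFin X
  have hS := isHermitian_cfc_sqrt ρ
  have hSS := cfc_sqrt_mul_self hρ.posSemidef
  set S := cfc Real.sqrt ρ
  have hdet : IsUnit S.det :=
    (isUnit_iff_isUnit_det S).1 (isUnit_of_mul_isUnit_left (hSS ▸ hρ.isUnit))
  set K : Matrix (Fin (Fintype.card A)) A ℂ := S.submatrix e.symm id with hK
  set K' : Matrix A (Fin (Fintype.card A)) ℂ := S⁻¹.submatrix id e.symm with hK'
  have hKK' : K * K' = 1 := by
    rw [hK, hK', ← submatrix_mul S S⁻¹ e.symm id e.symm Function.bijective_id, mul_nonsing_inv S hdet,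
      submatrix_one_equiv]
  have hK'K : K' * K = 1 := by
    rw [hK, hK', submatrix_mul_equiv S⁻¹ S id e.symm id, nonsing_inv_mul S hdet, submatrix_id_id]
  have hKK : Kᴴ * K = ρ := by
    rw [hK, conjTranspose_submatrix, hS.eq, submatrix_mul_equiv S S id e.symm id, hSS,
      submatrix_id_id]
  set W := K ⊗ₖ (1 : Matrix B B ℂ) with hW
  set W' := K' ⊗ₖ (1 : Matrix B B ℂ) with hW'
  have hW'W : W' * W = 1 := by
    rw [hW, hW', ← mul_kronecker_mul, hK'K, mul_one, one_kronecker_one]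
  have hWW' : W * W' = 1 := by
    rw [hW, hW', ← mul_kronecker_mul, hKK', mul_one, one_kronecker_one]
  have hWWh : Wᴴ * W'ᴴ = 1 := by rw [← conjTranspose_mul, hW'W, conjTranspose_one]
  have hWWh' : W'ᴴ * Wᴴ = 1 := by rw [← conjTranspose_mul, hWW', conjTranspose_one]
  have hsum : ∑ s : Unit, ((fun _ => K) s)ᴴ * (fun _ => K) s = ρ := by simp [hKK]
  have htr := transpose_sum_conjTranspose_mul (fun _ : Unit => K)
  rw [hsum] at htr
  have hstat : ∀ (Φ : Matrix A A ℂ →ₗ[ℂ] Matrix B B ℂ) (x : X),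
      (W'ᴴ * G x * W' * idTensor Φ (ofAmplitudes fun _ : Unit => K)).trace.re = outcome Φ G x := by
    intro Φ x
    rw [trace_mul_idTensor_ofAmplitudes, outcome]
    simp only [Finset.univ_unique, Finset.sum_singleton]
    rw [← hW, ← Matrix.mul_assoc, ← Matrix.mul_assoc, hWWh, Matrix.one_mul,
      Matrix.mul_assoc (G x), hW'W, Matrix.mul_one]
  -- The input is the pure state with amplitude `√ρ`, reindexed by `Fin`; conjugating by its inverse
  -- turns the sum `ρ ⊗ 1` into the identity.
  have hPOVM : IsPOVM fun x : Fin (Fintype.card X) => W'ᴴ * G (eX.symm x) * W' := by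
    refine ⟨fun x => (hG.1 _).conjTranspose_mul_mul_same _, ?_⟩
    rw [eX.symm.sum_comp fun x => W'ᴴ * G x * W', ← Matrix.sum_mul, ← Matrix.mul_sum, hG.2,
      ← hKK]
    have : (Kᴴ * K) ⊗ₖ (1 : Matrix B B ℂ) = Wᴴ * W := by
      rw [hW, conjTranspose_kronecker, conjTranspose_one, ← mul_kronecker_mul, mul_one]
    rw [this, ← Matrix.mul_assoc, hWWh', Matrix.one_mul, hWW']
  have h1 : relEntropy (outcome N G) (outcome M G)
      ≤ measuredRelEntropy (idTensor N (ofAmplitudes fun _ : Unit => K))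
        (idTensor M (ofAmplitudes fun _ : Unit => K)) := by
    refine le_sSup ⟨_, _, hPOVM, ?_⟩
    simp only [hstat]
    exact (relEntropy_comp_equiv eX.symm _ _).symm
  refine h1.trans (le_sSup ⟨_, _, ⟨posSemidef_ofAmplitudes _, ?_⟩, ?_, rfl⟩)
  · rw [← trace_partialTraceLeft, ← htr, trace_transpose, hfeas.1]
  · rw [← htr]; exact hfeas.2

end Testers

/-! ### Variational form of the classical relative entropy. -/

section ClassicalRelativeEntropy

variable {X : Type*} [Fintype X]

theorem relEntropy_eq_coe {p q : X → ℝ} (h : ∀ x, q x = 0 → p x = 0) :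
    relEntropy p q = ((∑ x, p x * Real.log (p x / q x) : ℝ) : EReal) := by
  rw [relEntropy, if_pos h]

theorem eq_zero_of_relEntropy_ne_top {p q : X → ℝ} (h : relEntropy p q ≠ ⊤) :
    ∀ x, q x = 0 → p x = 0 := by
  by_contra hc
  exact h (by rw [relEntropy, if_neg hc])

/-- Gibbs' variational inequality for a single outcome. -/
theorem mul_log_sub_mul_le {p q y : ℝ} (hp : 0 ≤ p) (hq : 0 ≤ q) (hpq : q = 0 → p = 0)
    (hy : 0 < y) : p * Real.log y - q * y ≤ p * Real.log (p / q) - p := by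
  rcases eq_or_lt_of_le hp with rfl | hp
  · simp; positivity
  have hq : 0 < q := lt_of_le_of_ne hq fun h => hp.ne' (hpq h.symm)
  have h1 := Real.log_le_sub_one_of_pos (x := y * q / p) (by positivity)
  have h2 : Real.log (y * q / p) = Real.log y - Real.log (p / q) := by
    rw [Real.log_div (by positivity) (by positivity), Real.log_mul (by positivity) (by positivity),
      Real.log_div (by positivity) (by positivity)]
    ring
  rw [h2] at h1
  have h3 := mul_le_mul_of_nonneg_left h1 hp.le
  have h4 : p * (y * q / p - 1) = q * y - p := by field_simp
  linarith

/-- Truncating the optimal weight `p / q` from below at `δ` costs at most `q * δ`. -/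
theorem mul_log_div_sub_le {p q δ : ℝ} (hp : 0 ≤ p) (hq : 0 ≤ q) (hpq : q = 0 → p = 0)
    (hδ : 0 < δ) :
    p * Real.log (p / q) - p ≤ p * Real.log (max (p / q) δ) - q * max (p / q) δ + q * δ := by
  rcases eq_or_lt_of_le hq with rfl | hq
  · simp [hpq rfl]
  rcases le_total δ (p / q) with h | h
  · rw [max_eq_left h, mul_div_cancel₀ _ hq.ne']
    nlinarith
  · rw [max_eq_right h]
    rcases eq_or_lt_of_le hp with rfl | hp
    · simp
    have := mul_le_mul_of_nonneg_left (Real.log_le_log (by positivity) h) hp.le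
    linarith

/-- Variational upper bound on the classical relative entropy. -/
theorem relEntropy_le_of_forall_weight {p q : X → ℝ} (hp : ∀ x, 0 ≤ p x) (hq : ∀ x, 0 ≤ q x)
    (hp1 : ∑ x, p x = 1) {V : EReal}
    (h : ∀ w : X → ℝ, (∀ x, 0 < w x) →
      ((∑ x, (p x * Real.log (w x) - q x * w x) + 1 : ℝ) : EReal) ≤ V) :
    relEntropy p q ≤ V := by
  by_cases hpq : ∀ x, q x = 0 → p x = 0
  · rw [relEntropy_eq_coe hpq]
    have hlim : Filter.Tendsto (fun n : ℕ => ((∑ x, p x * Real.log (p x / q x)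
        - 1 / ((n : ℝ) + 1) * ∑ x, q x : ℝ) : EReal)) Filter.atTop
        (𝓝 ((∑ x, p x * Real.log (p x / q x) : ℝ) : EReal)) := by
      refine (continuous_coe_real_ereal.tendsto _).comp ?_
      simpa using ((tendsto_one_div_add_atTop_nhds_zero_nat (𝕜 := ℝ)).mul_const
        (∑ x, q x)).const_sub (∑ x, p x * Real.log (p x / q x))
    refine le_of_tendsto' hlim fun n => ?_
    have hδ : (0 : ℝ) < 1 / ((n : ℝ) + 1) := Nat.one_div_pos_of_nat
    refine le_trans ?_ (h (fun x => max (p x / q x) (1 / ((n : ℝ) + 1)))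
      fun x => lt_max_of_lt_right hδ)
    rw [EReal.coe_le_coe_iff]
    have := Finset.sum_le_sum fun x (_ : x ∈ Finset.univ) =>
      mul_log_div_sub_le (hp x) (hq x) (hpq x) hδ
    rw [Finset.sum_sub_distrib, Finset.sum_add_distrib, hp1, ← Finset.sum_mul] at this
    linarith
  · have hV : ∀ c : ℝ, (c : EReal) ≤ V := by
      classical
      push Not at hpq
      obtain ⟨x₀, hq0, hp0⟩ := hpq
      intro c
      -- At `x₀` a large weight costs nothing since `q x₀ = 0`; the exponent makes the objective
      -- exactly `c`.
      refine le_of_eq_of_le ?_ (h (Function.update (fun _ => 1) x₀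
        (Real.exp ((c + ∑ x, q x - 1) / p x₀))) fun x => ?_)
      · congr 1
        rw [Finset.sum_sub_distrib, Finset.sum_eq_single x₀]
        · have : ∑ x, q x * Function.update (fun _ => (1 : ℝ)) x₀
              (Real.exp ((c + ∑ x, q x - 1) / p x₀)) x = ∑ x, q x := by
            refine Finset.sum_congr rfl fun x _ => ?_
            by_cases hx : x = x₀
            · rw [hx, hq0, zero_mul]
            · rw [Function.update_of_ne hx, mul_one]
          rw [this, Function.update_self, Real.log_exp, mul_div_cancel₀ _ hp0]
          ring
        · intro x _ hx
          rw [Function.update_of_ne hx, Real.log_one, mul_zero]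
        · simp
      · by_cases hx : x = x₀
        · rw [hx, Function.update_self]; exact Real.exp_pos _
        · rw [Function.update_of_ne hx]; exact one_pos
    have : V = ⊤ := (EReal.eq_top_iff_forall_lt V).2 fun y =>
      lt_of_lt_of_le (EReal.coe_lt_coe_iff.2 (lt_add_one y)) (hV (y + 1))
    rw [this]
    exact le_top

end ClassicalRelativeEntropy

/-! ### Normalization, perturbation and domination of tester statistics. -/

section TesterStatistics

variable {A B X : Type*} [Fintype A] [DecidableEq A] [Fintype B] [DecidableEq B] [Fintype X]
  {N M Φ : Matrix A A ℂ →ₗ[ℂ] Matrix B B ℂ} {H : Matrix A A ℂ} {E : ℝ} {ρ : Matrix A A ℂ}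
  {G : X → Matrix (A × B) (A × B) ℂ}

omit [Fintype X] in
theorem outcome_nonneg (hΦ : IsCompletelyPositive Φ) (hG : ∀ x, (G x).PosSemidef) (x : X) :
    0 ≤ outcome Φ G x :=
  re_trace_mul_nonneg (hG x) (posSemidef_choi hΦ)

theorem re_trace_sum_smul_mul_choi (a : X → ℝ) :
    ((∑ x, (a x : ℂ) • G x) * choi Φ).trace.re = ∑ x, outcome Φ G x * a x := by
  rw [Finset.sum_mul, trace_sum, Complex.re_sum]
  refine Finset.sum_congr rfl fun x _ => ?_
  rw [smul_mul_assoc, trace_smul, smul_eq_mul, Complex.re_ofReal_mul, outcome, mul_comm]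

theorem sum_outcome (hG : IsTester ρ G) :
    ∑ x, outcome Φ G x = ((ρ ⊗ₖ (1 : Matrix B B ℂ)) * choi Φ).trace.re := by
  have := re_trace_sum_smul_mul_choi (Φ := Φ) (G := G) fun _ => 1
  simp only [Complex.ofReal_one, one_smul, mul_one] at this
  rw [← this, hG.2]

/-- Trace preservation says that tracing `B` out of `choi N` leaves the identity. -/
theorem sum_outcome_eq_one (hN : IsChannel N) (hρ : ρ.trace = 1) (hG : IsTester ρ G) :
    ∑ x, outcome N G x = 1 := by
  rw [sum_outcome hG]
  have h1 : ((ρ ⊗ₖ (1 : Matrix B B ℂ)) * choi N).trace = ρ.trace := by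
    have h2 : ∀ i j : A, ∑ b, choi N (i, b) (j, b) = if i = j then 1 else 0 := by
      intro i j
      simp only [choi_apply]
      have h3 := hN.2 (single i j 1)
      rw [trace] at h3
      simp only [diag_apply] at h3
      rw [h3]
      split_ifs with hij
      · subst hij; exact trace_single_eq_same i 1
      · exact trace_single_eq_of_ne i j 1 hij
    simp only [trace, diag_apply, mul_apply, Fintype.sum_prod_type, kronecker_apply, one_apply,
      mul_ite, mul_one, mul_zero, ite_mul, zero_mul, Finset.sum_ite_eq, Finset.mem_univ, if_true]
    refine Finset.sum_congr rfl fun i _ => ?_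
    rw [Finset.sum_comm]
    simp only [← Finset.mul_sum, h2]
    simp
  rw [h1, hρ, Complex.one_re]

omit [DecidableEq A] in
theorem posDef_kronecker_one (hρ : ρ.PosDef) : (ρ ⊗ₖ (1 : Matrix B B ℂ)).PosDef :=
  hρ.kronecker PosDef.one

theorem sum_outcome_le (hM : IsCompletelyPositive M) (hρ : ρ.PosSemidef) (hρ1 : ρ.trace = 1)
    (hG : IsTester ρ G) : ∑ x, outcome M G x ≤ (choi M).trace.re := by
  rw [sum_outcome hG]
  have h1 := posSemidef_trace_smul_one_sub hρ
  rw [hρ1, Complex.one_re, Complex.ofReal_one, one_smul] at h1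
  have h2 := re_trace_mul_nonneg (h1.kronecker (PosSemidef.one (n := B) (R := ℂ)))
    (posSemidef_choi hM)
  have h3 : (1 - ρ) ⊗ₖ (1 : Matrix B B ℂ) = 1 - ρ ⊗ₖ (1 : Matrix B B ℂ) := by
    rw [← one_kronecker_one (m := A) (n := B)]
    ext p q
    exact sub_mul _ _ _
  rw [h3, sub_mul, one_mul, trace_sub, Complex.sub_re] at h2
  linarith

/-- Bounds on affine functions of the statistics extend from testers with invertible `ρ` to all
testers. -/
theorem le_of_forall_posDef_tester (hN : IsChannel N)
    (hE : (∃ ρ : Matrix A A ℂ, IsDensity ρ ∧ (H * ρ).trace.re ≤ E) →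
      ∃ ρ : Matrix A A ℂ, ρ.PosDef ∧ ρ.trace = 1 ∧ (H * ρ).trace.re ≤ E)
    (hρ : ρ.PosSemidef) (hfeas : IsFeasible H E ρ) (hG : IsTester ρ G) (a w : X → ℝ) {V : EReal}
    (h : ∀ (ρ' : Matrix A A ℂ) (G' : X → Matrix (A × B) (A × B) ℂ), ρ'.PosDef →
      IsFeasible H E ρ' → IsTester ρ' G' →
      ((∑ x, (outcome N G' x * a x - outcome M G' x * w x) + 1 : ℝ) : EReal) ≤ V) :
    ((∑ x, (outcome N G x * a x - outcome M G x * w x) + 1 : ℝ) : EReal) ≤ V := by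
  obtain ⟨ρ₁, hρ₁, htr, hen⟩ := hE ⟨ρᵀ, ⟨hρ.transpose, by rw [trace_transpose, hfeas.1]⟩, hfeas.2⟩
  have hX : Nonempty X := by
    by_contra hX
    rw [not_nonempty_iff] at hX
    have := sum_outcome_eq_one hN hfeas.1 hG
    simp at this
  have hcard : (0 : ℝ) < (Fintype.card X : ℝ)⁻¹ := by positivity
  -- Mixing in a small multiple of this uniform tester of an invertible feasible state makes `ρ`
  -- invertible while keeping the constraints. Affine functions of the statistics pass to the limit.
  set G₀ : X → Matrix (A × B) (A × B) ℂ :=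
    fun _ => (((Fintype.card X : ℝ)⁻¹ : ℝ) : ℂ) • (ρ₁ᵀ ⊗ₖ (1 : Matrix B B ℂ)) with hG₀
  set t : ℕ → ℝ := fun n => 1 / ((n : ℝ) + 1) with ht
  have ht0 : ∀ n, 0 < t n := fun n => Nat.one_div_pos_of_nat
  have ht1 : ∀ n, t n ≤ 1 := fun n => by
    rw [ht, div_le_one (by positivity)]
    linarith [(Nat.cast_nonneg n : (0 : ℝ) ≤ n)]
  set φ : (X → Matrix (A × B) (A × B) ℂ) → ℝ :=
    fun G => ∑ x, (outcome N G x * a x - outcome M G x * w x) with hφ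
  have hlim : Filter.Tendsto (fun n : ℕ => (((1 - t n) * φ G + t n * φ G₀ + 1 : ℝ) : EReal))
      Filter.atTop (𝓝 ((φ G + 1 : ℝ) : EReal)) := by
    refine (continuous_coe_real_ereal.tendsto _).comp ?_
    have h0 : Filter.Tendsto t Filter.atTop (𝓝 0) := tendsto_one_div_add_atTop_nhds_zero_nat
    simpa using (((h0.const_sub 1).mul_const (φ G)).add (h0.mul_const (φ G₀))).add_const 1
  refine le_of_tendsto' hlim fun n => ?_
  have houtc : ∀ (Φ : Matrix A A ℂ →ₗ[ℂ] Matrix B B ℂ) (x : X),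
      outcome Φ (fun x => ((1 - t n : ℝ) : ℂ) • G x + (t n : ℂ) • G₀ x) x
        = (1 - t n) * outcome Φ G x + t n * outcome Φ G₀ x := by
    intro Φ x
    simp only [outcome, add_mul, smul_mul_assoc, trace_add, trace_smul, smul_eq_mul,
      Complex.add_re, Complex.re_ofReal_mul]
  have hmain := h (((1 - t n : ℝ) : ℂ) • ρ + (t n : ℂ) • ρ₁ᵀ)
    (fun x => ((1 - t n : ℝ) : ℂ) • G x + (t n : ℂ) • G₀ x) ?_ ⟨?_, ?_⟩ ⟨fun x => ?_, ?_⟩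
  · refine le_of_eq_of_le ?_ hmain
    congr 2
    simp only [hφ, houtc, Finset.mul_sum, ← Finset.sum_add_distrib]
    exact Finset.sum_congr rfl fun x _ => by ring
  · exact PosDef.posSemidef_add (posSemidef_smul_real hρ (sub_nonneg.2 (ht1 n)))
      (hρ₁.transpose.smul (Complex.zero_lt_real.2 (ht0 n)))
  · rw [trace_add, trace_smul, trace_smul, trace_transpose, hfeas.1, htr]
    simp
  · rw [transpose_add, transpose_smul, transpose_smul, transpose_transpose, mul_add, mul_smul_comm,
      mul_smul_comm, trace_add, trace_smul, trace_smul, smul_eq_mul, smul_eq_mul, Complex.add_re,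
      Complex.re_ofReal_mul, Complex.re_ofReal_mul]
    nlinarith [mul_le_mul_of_nonneg_left hfeas.2 (sub_nonneg.2 (ht1 n)),
      mul_le_mul_of_nonneg_left hen (ht0 n).le]
  · exact (posSemidef_smul_real (hG.1 x) (sub_nonneg.2 (ht1 n))).add (posSemidef_smul_real
      (posSemidef_smul_real (posDef_kronecker_one hρ₁.transpose).posSemidef hcard.le) (ht0 n).le)
  · rw [Finset.sum_add_distrib, ← Finset.smul_sum, ← Finset.smul_sum, hG.2, add_kronecker,
      smul_kronecker, smul_kronecker]
    congr 2
    rw [hG₀, Finset.sum_const, Finset.card_univ, ← Nat.cast_smul_eq_nsmul ℂ, smul_smul]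
    push_cast
    rw [mul_inv_cancel₀ (by exact_mod_cast Fintype.card_ne_zero), one_smul]

/-- The spectral tester of `ρ ⊗ 1` and `Ω`. -/
theorem exists_spectral_tester (hρ : ρ.PosDef) {Ω : Matrix (A × B) (A × B) ℂ} (hΩ : Ω.PosDef) :
    ∃ (G : A × B → Matrix (A × B) (A × B) ℂ) (y : A × B → ℝ), IsTester ρ G ∧ (∀ i, 0 < y i) ∧
      Ω = ∑ i, (y i : ℂ) • G i ∧
      logPerspective (ρ ⊗ₖ (1 : Matrix B B ℂ)) Ω = ∑ i, (Real.log (y i) : ℂ) • G i ∧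
      ∀ (m k : ℕ) (Θ : Matrix (A × B) (A × B) ℂ),
        IsCertified m k (ρ ⊗ₖ (1 : Matrix B B ℂ)) Ω Θ →
        (∑ i, (approxLog m k (y i) : ℂ) • G i - Θ).PosSemidef := by
  obtain ⟨J, y, hJ, hy, hX, hY, hlog⟩ :=
    exists_joint_diagonalization (posDef_kronecker_one (B := B) hρ) hΩ
  have hdiag : ∀ c : A × B → ℝ, Jᴴ * (diagonal fun i => (c i : ℂ)) * J
      = ∑ i, (c i : ℂ) • (Jᴴ * single i i 1 * J) := by
    intro c
    have h1 : (diagonal fun i => (c i : ℂ)) = ∑ i, (c i : ℂ) • single i i (1 : ℂ) := by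
      ext i j
      rw [Matrix.sum_apply, Finset.sum_eq_single i]
      · simp [single_apply, diagonal_apply]
      · intro k _ hk; simp [hk]
      · simp
    rw [h1, Finset.mul_sum, Finset.sum_mul]
    exact Finset.sum_congr rfl fun i _ => by rw [mul_smul_comm, smul_mul_assoc]
  refine ⟨fun i => Jᴴ * single i i 1 * J, y, ⟨fun i => ?_, ?_⟩, hy, ?_, ?_, fun m k Θ h => ?_⟩
  · refine PosSemidef.conjTranspose_mul_mul_same ?_ J
    rw [← diagonal_single]
    exact PosSemidef.diagonal (Pi.single_nonneg.2 zero_le_one)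
  · have := hdiag fun _ => 1
    simp only [Complex.ofReal_one, one_smul, diagonal_one, mul_one] at this
    rw [← this, hX]
  · rw [← hdiag, ← hY]
  · rw [← hdiag, ← hlog]
  · rw [← hdiag]
    rw [hX, hY] at h
    exact h.posSemidef_sub hJ hy

/-- If the measured relative entropy is finite, then the statistics are uniformly dominated. -/
theorem exists_outcome_le_mul (hN : IsChannel N) (hM : IsCompletelyPositive M)
    (hD : channelMeasuredRelEntropy N M H E ≠ ⊤) {ρ₀ : Matrix A A ℂ} (hρ₀ : ρ₀.PosDef)
    (hfeas : IsFeasible H E ρ₀) :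
    ∃ C : ℝ, 0 < C ∧ ((C : ℂ) • choi M - choi N).PosSemidef := by
  refine exists_posSemidef_smul_sub (posSemidef_choi hN.1) (posSemidef_choi hM) fun v hv => ?_
  have hX := posDef_kronecker_one (B := B) hρ₀
  have hV := posSemidef_vecMulVec_self_star v
  have htr : ∀ Γ : Matrix (A × B) (A × B) ℂ,
      (vecMulVec v (star v) * Γ).trace = star v ⬝ᵥ (Γ *ᵥ v) := by
    intro Γ
    rw [vecMulVec_mul, trace_vecMulVec, dotProduct_comm, dotProduct_mulVec]
  obtain ⟨C, hC, hdom⟩ := exists_posSemidef_smul_sub hV hX.posSemidef fun u hu => by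
    by_cases h0 : u = 0
    · simp [h0]
    · exact absurd hu (hX.dotProduct_mulVec_pos h0).ne'
  have hCi : (0 : ℝ) ≤ C⁻¹ := (inv_pos.2 hC).le
  have hCC : ((C⁻¹ : ℝ) : ℂ) * (C : ℂ) = 1 := by
    rw [← Complex.ofReal_mul, inv_mul_cancel₀ hC.ne', Complex.ofReal_one]
  -- The first outcome has probability zero under `M` because `⟨v, Γ^M v⟩ = 0`; finiteness forces
  -- the same under `N`. Scaling by `C⁻¹` keeps the second effect positive.
  set G : Fin 2 → Matrix (A × B) (A × B) ℂ := ![((C⁻¹ : ℝ) : ℂ) • vecMulVec v (star v),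
    ρ₀ ⊗ₖ (1 : Matrix B B ℂ) - ((C⁻¹ : ℝ) : ℂ) • vecMulVec v (star v)] with hGdef
  have hG : IsTester ρ₀ G := by
    refine ⟨fun x => ?_, by simp [hGdef, Fin.sum_univ_two]⟩
    fin_cases x
    · exact posSemidef_smul_real hV hCi
    · have := posSemidef_smul_real hdom hCi
      rw [smul_sub, smul_smul, hCC, one_smul] at this
      exact this
  have hout : ∀ Φ : Matrix A A ℂ →ₗ[ℂ] Matrix B B ℂ,
      outcome Φ G 0 = C⁻¹ * (star v ⬝ᵥ (choi Φ *ᵥ v)).re := by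
    intro Φ
    rw [outcome, ← htr]
    simp only [hGdef, cons_val_zero, smul_mul_assoc, trace_smul, smul_eq_mul,
      Complex.re_ofReal_mul]
  have hne : relEntropy (outcome N G) (outcome M G) ≠ ⊤ := fun htop =>
    hD (top_le_iff.1 (htop ▸ relEntropy_outcome_le hρ₀ hfeas hG))
  have h0 := eq_zero_of_relEntropy_ne_top hne 0 (by rw [hout, hv]; simp)
  rw [hout] at h0
  have hre := (mul_eq_zero.1 h0).resolve_left (inv_pos.2 hC).ne'
  have hnn := (posSemidef_choi hN.1).dotProduct_mulVec_nonneg v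
  exact Complex.ext hre (Complex.le_def.1 hnn).2.symm

omit [Fintype X] in
theorem outcome_le_mul {C : ℝ} (hC : ((C : ℂ) • choi M - choi N).PosSemidef)
    (hG : ∀ x, (G x).PosSemidef) (x : X) : outcome N G x ≤ C * outcome M G x := by
  have := re_trace_mul_nonneg (hG x) hC
  rw [mul_sub, mul_smul_comm, trace_sub, trace_smul, smul_eq_mul, Complex.sub_re,
    Complex.re_ofReal_mul] at this
  simp only [outcome]
  linarith

end TesterStatistics

/-! ### The variational formula and the error of the semidefinite programs. -/

section Optimization

variable {A B : Type*} [Fintype A] [DecidableEq A] [Fintype B] [DecidableEq B]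
  {N M : Matrix A A ℂ →ₗ[ℂ] Matrix B B ℂ} {H : Matrix A A ℂ} {E : ℝ}

/-- Bounding the measured relative entropy of channels by bounding that of all testers. -/
theorem channelMeasuredRelEntropy_le {V : EReal}
    (h : ∀ (n : ℕ) (ρ : Matrix A A ℂ) (G : Fin n → Matrix (A × B) (A × B) ℂ), ρ.PosSemidef →
      IsFeasible H E ρ → IsTester ρ G → relEntropy (outcome N G) (outcome M G) ≤ V) :
    channelMeasuredRelEntropy N M H E ≤ V := by
  refine sSup_le ?_
  rintro _ ⟨r, σ, hσ, hσE, rfl⟩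
  refine sSup_le ?_
  rintro _ ⟨n, L, hL, rfl⟩
  obtain ⟨ρ, G, hρ, hfeas, hG, hp, hq⟩ := exists_isTester (N := N) (M := M) hσ hσE hL
  rw [hp, hq]
  exact h n ρ G hρ hfeas hG

/-- The variational formula for the measured relative entropy of channels. -/
theorem channelMeasuredRelEntropy_eq_sSup (hN : IsChannel N) (hM : IsCompletelyPositive M)
    (hE : (∃ ρ : Matrix A A ℂ, IsDensity ρ ∧ (H * ρ).trace.re ≤ E) →
      ∃ ρ : Matrix A A ℂ, ρ.PosDef ∧ ρ.trace = 1 ∧ (H * ρ).trace.re ≤ E) :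
    channelMeasuredRelEntropy N M H E =
      sSup {v : EReal |
        ∃ (Ω : Matrix (A × B) (A × B) ℂ) (ρ : Matrix A A ℂ) (Θ : Matrix (A × B) (A × B) ℂ),
          Ω.PosDef ∧ ρ.PosDef ∧ Θ.IsHermitian ∧ ρ.trace = 1 ∧ (H * ρᵀ).trace.re ≤ E ∧
          (logPerspective (ρ ⊗ₖ (1 : Matrix B B ℂ)) Ω - Θ).PosSemidef ∧
          v = (((Θ * choi N).trace.re - (Ω * choi M).trace.re + 1 : ℝ) : EReal)} := by
  refine le_antisymm ?_ (sSup_le ?_)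
  · refine channelMeasuredRelEntropy_le fun n ρ G hρ hfeas hG => ?_
    refine relEntropy_le_of_forall_weight (outcome_nonneg hN.1 hG.1) (outcome_nonneg hM hG.1)
      (sum_outcome_eq_one hN hfeas.1 hG) fun w hw => ?_
    refine le_of_forall_posDef_tester hN hE hρ hfeas hG (fun x => Real.log (w x)) w ?_
    intro ρ' G' hρ' hfeas' hG'
    have hX := hG'.2 ▸ posDef_kronecker_one (B := B) hρ'
    refine le_sSup ⟨∑ x, (w x : ℂ) • G' x, ρ', ∑ x, (Real.log (w x) : ℂ) • G' x,
      posDef_sum_smul hG'.1 hX hw, hρ', isHermitian_sum_smul (fun x => (hG'.1 x).1) _,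
      hfeas'.1, hfeas'.2, ?_, ?_⟩
    · rw [← hG'.2]
      exact posSemidef_logPerspective_sub_sum hG'.1 hX hw
    · rw [re_trace_sum_smul_mul_choi, re_trace_sum_smul_mul_choi, Finset.sum_sub_distrib]
  · rintro _ ⟨Ω, ρ, Θ, hΩ, hρ, -, htr, hen, hΘ, rfl⟩
    obtain ⟨G, y, hG, hy, hΩG, hlog, -⟩ := exists_spectral_tester (B := B) hρ hΩ
    refine le_trans ?_ (relEntropy_outcome_le hρ ⟨htr, hen⟩ hG)
    by_cases hpq : ∀ i, outcome M G i = 0 → outcome N G i = 0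
    · rw [relEntropy_eq_coe hpq, EReal.coe_le_coe_iff]
      have h1 := re_trace_mul_nonneg hΘ (posSemidef_choi hN.1)
      rw [hlog, sub_mul, trace_sub, Complex.sub_re, re_trace_sum_smul_mul_choi] at h1
      rw [hΩG, re_trace_sum_smul_mul_choi]
      have h2 := Finset.sum_le_sum fun i (_ : i ∈ Finset.univ) => mul_log_sub_mul_le
        (outcome_nonneg hN.1 hG.1 i) (outcome_nonneg hM hG.1 i) (hpq i) (hy i)
      rw [Finset.sum_sub_distrib, Finset.sum_sub_distrib, sum_outcome_eq_one hN htr hG] at h2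
      linarith
    · rw [relEntropy, if_neg hpq]
      exact le_top

theorem sdpValue_eq_sSup (m k : ℕ) :
    sdpValue N M H E m k = sSup {v : EReal |
      ∃ (Ω : Matrix (A × B) (A × B) ℂ) (ρ : Matrix A A ℂ) (Θ : Matrix (A × B) (A × B) ℂ),
        Ω.PosDef ∧ ρ.PosDef ∧ Θ.IsHermitian ∧ IsFeasible H E ρ ∧
        IsCertified m k (ρ ⊗ₖ (1 : Matrix B B ℂ)) Ω Θ ∧
        v = (((Θ * choi N).trace.re - (Ω * choi M).trace.re + 1 : ℝ) : EReal)} := by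
  rw [sdpValue]
  congr 1
  ext v
  constructor
  · rintro ⟨Ω, ρ, Θ, T, Z, h1, h2, h3, h4, h5, h6, h7, h8, h9, h10, h11, h12⟩
    exact ⟨Ω, ρ, Θ, h1, h2, h3, ⟨h6, h7⟩, ⟨T, Z, h4, h5, h8, h9, h10, h11⟩, h12⟩
  · rintro ⟨Ω, ρ, Θ, h1, h2, h3, ⟨h6, h7⟩, ⟨T, Z, h4, h5, h8, h9, h10, h11⟩, h12⟩
    exact ⟨Ω, ρ, Θ, T, Z, h1, h2, h3, h4, h5, h6, h7, h8, h9, h10, h11, h12⟩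

/-- The semidefinite program overshoots by at most the truncation and quadrature errors. -/
theorem sdpValue_le (hN : IsChannel N) (hM : IsCompletelyPositive M) {m k : ℕ} {δ η ε : ℝ}
    (hδ : 0 < δ) (happrox : ∀ x, δ ≤ x → approxLog m k x ≤ Real.log x + η)
    (hε : η + δ * (choi M).trace.re ≤ ε) :
    sdpValue N M H E m k ≤ channelMeasuredRelEntropy N M H E + (ε : EReal) := by
  rw [sdpValue_eq_sSup]
  refine sSup_le ?_
  rintro _ ⟨Ω, ρ, Θ, hΩ, hρ, -, hfeas, hcert, rfl⟩
  obtain ⟨G, y, hG, hy, hΩG, -, hupper⟩ := exists_spectral_tester (B := B) hρ hΩ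
  refine le_trans ?_ (add_le_add_left (relEntropy_outcome_le (N := N) (M := M) hρ hfeas hG) _)
  by_cases hpq : ∀ i, outcome M G i = 0 → outcome N G i = 0
  · rw [relEntropy_eq_coe hpq, ← EReal.coe_add, EReal.coe_le_coe_iff]
    have h1 := re_trace_mul_nonneg (hupper m k Θ hcert) (posSemidef_choi hN.1)
    rw [sub_mul, trace_sub, Complex.sub_re, re_trace_sum_smul_mul_choi] at h1
    rw [hΩG, re_trace_sum_smul_mul_choi]
    have h2 : ∀ i, outcome N G i * approxLog m k (y i) - outcome M G i * y i
        ≤ outcome N G i * Real.log (outcome N G i / outcome M G i) - outcome N G i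
          + (outcome N G i * η + outcome M G i * δ) := by
      intro i
      have hp := outcome_nonneg hN.1 hG.1 i
      have hq := outcome_nonneg hM hG.1 i
      -- Below `δ` the approximation may exceed `ln` uncontrollably. By monotonicity `y` can be
      -- raised to `max y δ`, costing at most `q δ`.
      have h3 := mul_log_sub_mul_le hp hq (hpq i) (lt_max_of_lt_left (c := δ) (hy i))
      have h4 := (approxLog_mono m k (hy i) (le_max_left _ δ)).trans
        (happrox _ (le_max_right (y i) δ))
      have h5 : max (y i) δ ≤ y i + δ := max_le (by linarith) (by linarith [hy i])
      nlinarith [mul_le_mul_of_nonneg_left h4 hp, mul_le_mul_of_nonneg_left h5 hq]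
    have h3 := Finset.sum_le_sum fun i (_ : i ∈ Finset.univ) => h2 i
    rw [Finset.sum_sub_distrib, Finset.sum_add_distrib, Finset.sum_sub_distrib,
      Finset.sum_add_distrib, ← Finset.sum_mul, ← Finset.sum_mul,
      sum_outcome_eq_one hN hfeas.1 hG] at h3
    have h4 := mul_le_mul_of_nonneg_left (sum_outcome_le hM hρ.posSemidef hfeas.1 hG) hδ.le
    linarith
  · rw [relEntropy, if_neg hpq, EReal.top_add_coe]
    exact le_top

/-- The semidefinite program undershoots by at most the truncation and quadrature errors. -/
theorem channelMeasuredRelEntropy_le_sdpValue_add (hN : IsChannel N)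
    (hM : IsCompletelyPositive M)
    (hE : (∃ ρ : Matrix A A ℂ, IsDensity ρ ∧ (H * ρ).trace.re ≤ E) →
      ∃ ρ : Matrix A A ℂ, ρ.PosDef ∧ ρ.trace = 1 ∧ (H * ρ).trace.re ≤ E)
    {C : ℝ} (hC : ((C : ℂ) • choi M - choi N).PosSemidef) {m k : ℕ} {δ η ε : ℝ} (hδ : 0 < δ)
    (happrox : ∀ x, δ ≤ x → x ≤ max C δ → Real.log x ≤ approxLog m k x + η)
    (hε : η + δ * (choi M).trace.re ≤ ε) :
    channelMeasuredRelEntropy N M H E ≤ sdpValue N M H E m k + (ε : EReal) := by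
  refine channelMeasuredRelEntropy_le fun n ρ G hρ hfeas hG => ?_
  have hp := outcome_nonneg hN.1 hG.1
  have hq := outcome_nonneg hM hG.1
  have hdom := outcome_le_mul hC hG.1
  have hpq : ∀ x, outcome M G x = 0 → outcome N G x = 0 := fun x hx =>
    le_antisymm (by simpa [hx] using hdom x) (hp x)
  -- The optimal weights, cut off below at `δ`; domination by `C` keeps them in `[δ, max C δ]`.
  -- Where `q = 0`, the quotient is `0` and the weight is `δ`.
  set w : Fin n → ℝ := fun x => max (outcome N G x / outcome M G x) δ with hw
  have hw0 : ∀ x, 0 < w x := fun x => lt_max_of_lt_right hδ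
  have hwC : ∀ x, w x ≤ max C δ := by
    intro x
    rcases eq_or_lt_of_le (hq x) with h0 | h0
    · rw [hw]
      simp only [← h0, div_zero, max_eq_right hδ.le]
      exact le_max_right _ _
    · exact max_le_max_right δ ((div_le_iff₀ h0).2 (hdom x))
  have hsdp : ((∑ x, (outcome N G x * approxLog m k (w x) - outcome M G x * w x) + 1 : ℝ) : EReal)
      ≤ sdpValue N M H E m k := by
    rw [sdpValue_eq_sSup]
    refine le_of_forall_posDef_tester hN hE hρ hfeas hG _ w ?_
    intro ρ' G' hρ' hfeas' hG'
    have hX := hG'.2 ▸ posDef_kronecker_one (B := B) hρ'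
    refine le_sSup ⟨∑ x, (w x : ℂ) • G' x, ρ', ∑ x, (approxLog m k (w x) : ℂ) • G' x,
      posDef_sum_smul hG'.1 hX hw0, hρ', isHermitian_sum_smul (fun x => (hG'.1 x).1) _,
      hfeas', ?_, ?_⟩
    · rw [← hG'.2]
      exact isCertified_sum m k hG'.1 hw0
    · rw [re_trace_sum_smul_mul_choi, re_trace_sum_smul_mul_choi, Finset.sum_sub_distrib]
  refine le_trans ?_ (add_le_add_left hsdp _)
  rw [relEntropy_eq_coe hpq, ← EReal.coe_add, EReal.coe_le_coe_iff]
  have h1 : ∀ x, outcome N G x * Real.log (outcome N G x / outcome M G x) - outcome N G x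
      ≤ (outcome N G x * approxLog m k (w x) - outcome M G x * w x)
        + (outcome N G x * η + outcome M G x * δ) := by
    intro x
    have h2 := mul_log_div_sub_le (hp x) (hq x) (hpq x) hδ
    have h3 := mul_le_mul_of_nonneg_left (happrox (w x) (le_max_right _ _) (hwC x)) (hp x)
    change _ ≤ outcome N G x * Real.log (w x) - outcome M G x * w x + _ at h2
    linarith
  have h2 := Finset.sum_le_sum fun x (_ : x ∈ Finset.univ) => h1 x
  rw [Finset.sum_sub_distrib, Finset.sum_add_distrib, Finset.sum_add_distrib, ← Finset.sum_mul,
    ← Finset.sum_mul, sum_outcome_eq_one hN hfeas.1 hG] at h2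
  have h3 := mul_le_mul_of_nonneg_left (sum_outcome_le hM hρ hfeas.1 hG) hδ.le
  linarith

theorem eq_bot_of_not_feasible
    (hE : (∃ ρ : Matrix A A ℂ, IsDensity ρ ∧ (H * ρ).trace.re ≤ E) →
      ∃ ρ : Matrix A A ℂ, ρ.PosDef ∧ ρ.trace = 1 ∧ (H * ρ).trace.re ≤ E)
    (h : ¬ ∃ ρ : Matrix A A ℂ, ρ.PosDef ∧ IsFeasible H E ρ) :
    channelMeasuredRelEntropy N M H E = ⊥ := by
  refine le_bot_iff.1 (channelMeasuredRelEntropy_le fun n ρ G hρ hfeas hG => ?_)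
  obtain ⟨ρ₁, hρ₁, htr, hen⟩ := hE ⟨ρᵀ, ⟨hρ.transpose, by rw [trace_transpose, hfeas.1]⟩, hfeas.2⟩
  exact absurd ⟨ρ₁ᵀ, hρ₁.transpose, by rw [trace_transpose, htr], by rwa [transpose_transpose]⟩ h

/-- The semidefinite programs approximate a finite measured relative entropy of channels. -/
theorem exists_sdp_params (hN : IsChannel N) (hM : IsCompletelyPositive M)
    (hE : (∃ ρ : Matrix A A ℂ, IsDensity ρ ∧ (H * ρ).trace.re ≤ E) →
      ∃ ρ : Matrix A A ℂ, ρ.PosDef ∧ ρ.trace = 1 ∧ (H * ρ).trace.re ≤ E)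
    (hD : channelMeasuredRelEntropy N M H E ≠ ⊤) :
    ∃ m k : ℝ → ℕ,
      (fun ε : ℝ => ((m ε + k ε : ℕ) : ℝ)) =O[𝓝[>] 0]
        (fun ε : ℝ => Real.sqrt (Real.log (1 / ε))) ∧
      ∀ ε : ℝ, 0 < ε → 0 < m ε ∧
        channelMeasuredRelEntropy N M H E ≤ sdpValue N M H E (m ε) (k ε) + (ε : EReal) ∧
        sdpValue N M H E (m ε) (k ε) ≤ channelMeasuredRelEntropy N M H E + (ε : EReal) := by
  -- `C` is fixed before `ε`. Domination is available only in the feasible case; otherwise the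
  -- channel quantity is `⊥` and no lower bound on the program is needed.
  obtain ⟨C, hC⟩ : ∃ C : ℝ, (∃ ρ : Matrix A A ℂ, ρ.PosDef ∧ IsFeasible H E ρ) →
      ((C : ℂ) • choi M - choi N).PosSemidef := by
    by_cases h : ∃ ρ : Matrix A A ℂ, ρ.PosDef ∧ IsFeasible H E ρ
    · obtain ⟨ρ, hρ, hfeas⟩ := h
      obtain ⟨C, -, hC⟩ := exists_outcome_le_mul hN hM hD hρ hfeas
      exact ⟨C, fun _ => hC⟩
    · exact ⟨0, fun h' => absurd h' h⟩
  set Q := (choi M).trace.re with hQ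
  have hQ0 : 0 ≤ Q := (Complex.le_def.1 (posSemidef_choi hM).trace_nonneg).1
  obtain ⟨m, k, hO, hmk⟩ := exists_approxLog_params
    (Real.log (2 * (Q + 1)) + Real.log (max C 1))
  refine ⟨m, k, hO, fun ε hε => ⟨(hmk ε hε).1, ?_⟩⟩
  have happ := (hmk ε hε).2
  set e := min ε 1 with he
  have he0 : 0 < e := lt_min hε one_pos
  -- Truncation and quadrature each receive half of `e`: here `δ Q ≤ e / 2`. On `[δ, max C 1]`, `|ln
  -- x|` exceeds `ln(1/e)` by at most the constant passed to `exists_approxLog_params`.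
  set δ := e / (2 * (Q + 1)) with hδ
  have hδ0 : 0 < δ := by positivity
  have hδ1 : δ ≤ 1 := by
    rw [hδ, div_le_one (by positivity)]
    linarith [min_le_right ε 1]
  have hC1 : 0 ≤ Real.log (max C 1) := Real.log_nonneg (le_max_right _ _)
  have hQ1 : 0 ≤ Real.log (2 * (Q + 1)) := Real.log_nonneg (by linarith)
  have hlogδ : Real.log δ = -(Real.log (1 / e) + Real.log (2 * (Q + 1))) := by
    rw [hδ, Real.log_div he0.ne' (by positivity), one_div, Real.log_inv]
    ring
  have hle : 0 ≤ Real.log (1 / e) := Real.log_nonneg (by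
    rw [le_div_iff₀ he0]; linarith [min_le_right ε 1])
  have hbound : ∀ x, δ ≤ x → x ≤ max C 1 → |approxLog (m ε) (k ε) x - Real.log x| ≤ e / 2 := by
    intro x hx hxC
    have hx0 : 0 < x := hδ0.trans_le hx
    refine happ x hx0 (abs_le.2 ⟨?_, ?_⟩)
    · have := Real.log_le_log hδ0 hx
      linarith
    · have := Real.log_le_log hx0 hxC
      linarith
  have herr : e / 2 + δ * Q ≤ ε := by
    have : δ * Q ≤ e / 2 := by
      rw [hδ, div_mul_eq_mul_div, div_le_div_iff₀ (by positivity) two_pos]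
      nlinarith
    linarith [min_le_left ε 1]
  constructor
  · by_cases h : ∃ ρ : Matrix A A ℂ, ρ.PosDef ∧ IsFeasible H E ρ
    · refine channelMeasuredRelEntropy_le_sdpValue_add hN hM hE (hC h) hδ0
        (fun x hx hxC => ?_) herr
      have := abs_le.1 (hbound x hx (hxC.trans (max_le_max_left C hδ1)))
      linarith [this.1]
    · rw [eq_bot_of_not_feasible hE h]
      exact bot_le
  · refine sdpValue_le hN hM hδ0 (fun x hx => ?_) herr
    rcases le_total 1 x with h1 | h1
    · linarith [approxLog_le_log (m ε) (k ε) h1]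
    · have := abs_le.1 (hbound x hx (h1.trans (le_max_right _ _)))
      linarith [this.2]

end Optimization

end MeasuredChannel

theorem proposition12 {A B : Type*} [Fintype A] [DecidableEq A] [Fintype B] [DecidableEq B]
    (N M : Matrix A A ℂ →ₗ[ℂ] Matrix B B ℂ)
    (hN : MeasuredChannel.IsChannel N) (hM : MeasuredChannel.IsCompletelyPositive M)
    (H : Matrix A A ℂ) (hH : H.IsHermitian) (E : ℝ)
    (hE : (∃ ρ : Matrix A A ℂ, MeasuredChannel.IsDensity ρ ∧ (H * ρ).trace.re ≤ E) →
      ∃ ρ : Matrix A A ℂ, ρ.PosDef ∧ ρ.trace = 1 ∧ (H * ρ).trace.re ≤ E) :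
    MeasuredChannel.channelMeasuredRelEntropy N M H E =
        sSup {v : EReal |
          ∃ (Ω : Matrix (A × B) (A × B) ℂ) (ρ : Matrix A A ℂ) (Θ : Matrix (A × B) (A × B) ℂ),
            Ω.PosDef ∧ ρ.PosDef ∧ Θ.IsHermitian ∧
            ρ.trace = 1 ∧ (H * ρᵀ).trace.re ≤ E ∧
            (MeasuredChannel.logPerspective (ρ ⊗ₖ (1 : Matrix B B ℂ)) Ω - Θ).PosSemidef ∧
            v = (((Θ * MeasuredChannel.choi N).trace.re
              - (Ω * MeasuredChannel.choi M).trace.re + 1 : ℝ) : EReal)} ∧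
      (MeasuredChannel.channelMeasuredRelEntropy N M H E ≠ ⊤ →
        ∃ m k : ℝ → ℕ,
          (fun ε : ℝ => ((m ε + k ε : ℕ) : ℝ)) =O[𝓝[>] 0]
            (fun ε : ℝ => Real.sqrt (Real.log (1 / ε))) ∧
          ∀ ε : ℝ, 0 < ε → 0 < m ε ∧
            MeasuredChannel.channelMeasuredRelEntropy N M H E
              ≤ MeasuredChannel.sdpValue N M H E (m ε) (k ε) + (ε : EReal) ∧
            MeasuredChannel.sdpValue N M H E (m ε) (k ε)
              ≤ MeasuredChannel.channelMeasuredRelEntropy N M H E + (ε : EReal)) :=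
  ⟨MeasuredChannel.channelMeasuredRelEntropy_eq_sSup hN hM hE,
    MeasuredChannel.exists_sdp_params hN hM hE⟩
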